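/- Let $S$ be a right LCM semigroup with identity $1$: $S$ is left cancellative and for all $p,q\in S$ the set $pS\cap qS$ is either empty or equal to $rS$ for some $r\in S$. Let $A$ be a $C^*$-algebra and $M=\bigsqcup_{p\in S}M_p$ a product system of right-Hilbert $A$-bimodules over $S$: each $M_p$ is a right-Hilbert $A$-module with a left action $\varphi_p:A\to\mathcal L(M_p)$ by adjointable operators, $M$ is a semigroup with $M_pM_q\subset M_{pq}$, $M_1={}_AA_A$, products with elements of $M_1$ are given by the module actions, and for $p\neq 1$ the map $\xi\otimes\eta\mapsto\xi\eta$ induces an isomorphism $M_p\otimes_A M_q\cong M_{pq}$. Let $\Theta_{\xi,\eta}(\mu)=\xi\langle\eta,\mu\rangle_p$, let $\mathcal K(M_p)=\overline{\operatorname{span}}\{\Theta_{\xi,\eta}\mid \xi,\eta\in M_p\}$, and for $r=pq$ let $\iota_p^r(T)\in\mathcal L(M_r)$ be the operator $T\otimes\mathrm{id}$, so that $\iota_p^r(T)(\xi\eta)=(T\xi)\eta$ for $\xi\in M_p,\eta\in M_q$ (for $p=1$ it is defined on $\mathcal K(M_1)=A$ by $\iota_1^r(a)=\varphi_r(a)$).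 Suppose $M$ is compactly aligned: whenever $pS\cap qS=rS$, $T_p\in\mathcal K(M_p)$ and $T_q\in\mathcal K(M_q)$, one has $\iota_p^r(T_p)\iota_q^r(T_q)\in\mathcal K(M_r)$. A representation $\psi$ of $M$ in a $C^*$-algebra $B$ consists of linear maps $\psi_p:M_p\to B$, with $\psi_1:A\to B$ a $*$-homomorphism, $\psi_p(\xi)\psi_q(\eta)=\psi_{pq}(\xi\eta)$ and $\psi_p(\xi)^*\psi_p(\eta)=\psi_1(\langle\xi,\eta\rangle_p)$. Let $\psi^{(p)}:\mathcal K(M_p)\to B$ be the homomorphism with $\psi^{(p)}(\Theta_{\xi,\eta})=\psi_p(\xi)\psi_p(\eta)^*$. Call $\psi$ Nica covariant if for all $p,q\in S$, $T_p\in\mathcal K(M_p)$, $T_q\in\mathcal K(M_q)$, the product $\psi^{(p)}(T_p)\psi^{(q)}(T_q)$ equals $\psi^{(r)}(\iota_p^r(T_p)\iota_q^r(T_q))$ for every $r$ with $pS\cap qS=rS$, and equals $0$ if there is no such $r$. Let $F(M)$ be the Hilbert module direct sum of the fibres, that is, the set of families $(\xi_p)_{p\in S}$, $\xi_p\in M_p$,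 such that $\sum_p\langle\xi_p,\xi_p\rangle_p$ converges unconditionally in norm in $A$, with inner product $\langle\xi,\eta\rangle=\sum_p\langle\xi_p,\eta_p\rangle_p$. The Fock representation $\psi_F:M\to\mathcal L(F(M))$ is the representation of $M$ given by $(\psi_{F,p}(\xi)\eta)_{pr}=\xi\eta_r$ for $r\in S$ and $(\psi_{F,p}(\xi)\eta)_q=0$ for $q\notin pS$. Then $\psi_F$ is Nica covariant. Moreover, the Nica-Toeplitz algebra $\mathcal{NT}(M)$, i.e. the universal $C^*$-algebra generated by a Nica covariant representation of $M$, exists, and it is nonzero if $A\neq 0$. -/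

import Mathlib

/-! ### Hilbert modules and adjointable operators

Mathlib's `CStarModule C E` is a module over the C*-algebra `C` with a `C`-valued inner product such
that `⟪x, c • y⟫ = c * ⟪x, y⟫`.  A *right* Hilbert module over `A` is exactly a complete
`CStarModule` over the opposite algebra `Aᵐᵒᵖ`: writing `x · a := op a • x` and
`⟨x, y⟩_A := unop ⟪x, y⟫`, the axiom reads `⟨x, y · a⟩_A = ⟨x, y⟩_A * a`.  The general
constructions (adjointable operators, compact operators, Hilbert direct sums) are carried out for
`CStarModule C E`, and are then used with `C = Aᵐᵒᵖ`. -/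

set_option linter.unusedSectionVars false

namespace HilbertMod

section Basic

variable {C : Type*} [NonUnitalCStarAlgebra C] [PartialOrder C] [StarOrderedRing C]
variable {E : Type*} [NormedAddCommGroup E] [NormedSpace ℂ E] [SMul C E] [CStarModule C E]
variable {F : Type*} [NormedAddCommGroup F] [NormedSpace ℂ F] [SMul C F] [CStarModule C F]


variable (C) in
theorem ext_inner_left {x y : E} (h : ∀ z : E, inner C z x = inner C z y) : x = y := by
  rw [← sub_eq_zero, ← CStarModule.inner_self (A := C)]
  simp [CStarModule.inner_sub_right, h]

variable (C) in
theorem ext_inner_right {x y : E} (h : ∀ z : E, inner C x z = inner C y z) : x = y := by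
  apply ext_inner_left C
  intro z
  rw [← CStarModule.star_inner x z, ← CStarModule.star_inner y z, h]

theorem act_add (c : C) (x y : E) : c • (x + y) = c • x + c • y :=
  ext_inner_left C fun z => by simp [mul_add]

theorem add_act (c d : C) (x : E) : (c + d) • x = c • x + d • x :=
  ext_inner_left C fun z => by simp [add_mul]

theorem act_smul (c : C) (k : ℂ) (x : E) : c • (k • x) = k • (c • x) :=
  ext_inner_left C fun z => by simp [mul_smul_comm]

theorem smul_act (c : C) (k : ℂ) (x : E) : (k • c) • x = k • (c • x) :=
  ext_inner_left C fun z => by simp [smul_mul_assoc]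

theorem norm_act_le (c : C) (x : E) : ‖c • x‖ ≤ ‖c‖ * ‖x‖ := by
  have h : ‖c • x‖ ^ 2 ≤ (‖c‖ * ‖x‖) ^ 2 := by
    rw [CStarModule.norm_sq_eq (A := C)]
    calc ‖inner C (c • x) (c • x)‖ = ‖c * inner C x x * star c‖ := by simp [mul_assoc]
      _ ≤ ‖c‖ * ‖inner C x x‖ * ‖star c‖ :=
          (norm_mul_le _ _).trans (by gcongr; exact norm_mul_le _ _)
      _ = (‖c‖ * ‖x‖) ^ 2 := by
          rw [← CStarModule.norm_sq_eq (A := C), norm_star]; ring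
  exact (pow_le_pow_iff_left₀ (norm_nonneg _) (by positivity) (by simp)).mp h

/-- A bounded linear map with a formal adjoint satisfies `‖T'‖ ≤ ‖T‖`. -/
theorem norm_adjoint_le {T : E →L[ℂ] F} {T' : F →L[ℂ] E}
    (h : ∀ x y, inner C (T x) y = inner C x (T' y)) : ‖T'‖ ≤ ‖T‖ := by
  refine T'.opNorm_le_bound (norm_nonneg _) fun y => ?_
  have h1 : ‖T' y‖ * ‖T' y‖ ≤ ‖T‖ * ‖y‖ * ‖T' y‖ := by
    rw [← pow_two, CStarModule.norm_sq_eq (A := C), ← h]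
    calc ‖inner C (T (T' y)) y‖ ≤ ‖T (T' y)‖ * ‖y‖ := CStarModule.norm_inner_le F
      _ ≤ ‖T‖ * ‖T' y‖ * ‖y‖ := by gcongr; exact T.le_opNorm _
      _ = ‖T‖ * ‖y‖ * ‖T' y‖ := by ring
  rcases (norm_nonneg (T' y)).eq_or_lt with h0 | h0
  · rw [← h0]; positivity
  · exact le_of_mul_le_mul_right h1 h0

variable (C E) in
/-- The algebra `𝓛(E)` of adjointable operators on `E`. -/
def adjointable : Subalgebra ℂ (E →L[ℂ] E) where
  carrier := {T | ∃ T' : E →L[ℂ] E, ∀ x y, inner C (T x) y = inner C x (T' y)}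
  mul_mem' := by
    rintro S T ⟨S', hS⟩ ⟨T', hT⟩
    exact ⟨T' * S', fun x y => by simp [hS, hT]⟩
  add_mem' := by
    rintro S T ⟨S', hS⟩ ⟨T', hT⟩
    exact ⟨S' + T', fun x y => by simp [hS, hT]⟩
  algebraMap_mem' k := ⟨star k • 1, fun x y => by
    simp [Algebra.algebraMap_eq_smul_one]⟩

variable (C E) in
/-- The type of adjointable operators on `E`, normed by the operator norm. -/
def Adjointable : Type _ := adjointable C E

noncomputable instance : NormedRing (Adjointable C E) :=
  inferInstanceAs (NormedRing (adjointable C E))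

noncomputable instance : NormedAlgebra ℂ (Adjointable C E) :=
  inferInstanceAs (NormedAlgebra ℂ (adjointable C E))

instance : CoeFun (Adjointable C E) (fun _ => E → E) := ⟨fun T => T.1⟩

@[ext] theorem adjointable_ext {S T : Adjointable C E} (h : ∀ x, S x = T x) : S = T :=
  Subtype.ext (ContinuousLinearMap.ext h)

noncomputable instance : Star (Adjointable C E) where
  star T := ⟨T.2.choose, T.1, fun x y => by
    rw [← CStarModule.star_inner, ← T.2.choose_spec, CStarModule.star_inner]⟩

theorem inner_star_right (T : Adjointable C E) (x y : E) :
    inner C x (star T y) = inner C (T x) y := (T.2.choose_spec x y).symm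

theorem inner_star_left (T : Adjointable C E) (x y : E) :
    inner C (star T x) y = inner C x (T y) := by
  rw [← CStarModule.star_inner, inner_star_right, CStarModule.star_inner]

/-- An operator with a formal adjoint, as an element of `𝓛(E)`. -/
theorem star_eq_of {S T : Adjointable C E}
    (h : ∀ x y, inner C (T x) y = inner C x (S y)) : star T = S :=
  adjointable_ext fun y => ext_inner_left C fun x => by rw [inner_star_right, h]

noncomputable instance : StarRing (Adjointable C E) where
  star_involutive T := star_eq_of fun x y => inner_star_left T x y
  star_mul S T := star_eq_of fun x y => by
    change inner C (S (T x)) y = inner C x (star T (star S y))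
    rw [inner_star_right, inner_star_right]
  star_add S T := star_eq_of fun x y => by
    change inner C (S x + T x) y = inner C x (star S y + star T y)
    simp [inner_star_right]

noncomputable instance : StarModule ℂ (Adjointable C E) where
  star_smul k T := star_eq_of fun x y => by
    change inner C (k • T x) y = inner C x (star k • star T y)
    simp [inner_star_right]

theorem norm_star_mul_self_ge (T : Adjointable C E) : ‖T‖ * ‖T‖ ≤ ‖star T * T‖ := by
  have key : ‖T.1‖ ≤ √‖star T * T‖ := by
    refine T.1.opNorm_le_bound (Real.sqrt_nonneg _) fun x => ?_
    have : ‖T x‖ ^ 2 ≤ (√‖star T * T‖ * ‖x‖) ^ 2 := by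
      rw [CStarModule.norm_sq_eq (A := C), ← inner_star_right, mul_pow,
        Real.sq_sqrt (by positivity)]
      calc ‖inner C x (star T (T x))‖ ≤ ‖x‖ * ‖(star T * T) x‖ := CStarModule.norm_inner_le E
        _ ≤ ‖x‖ * (‖star T * T‖ * ‖x‖) := by gcongr; exact (star T * T).1.le_opNorm x
        _ = ‖star T * T‖ * ‖x‖ ^ 2 := by ring
    exact (pow_le_pow_iff_left₀ (norm_nonneg _) (by positivity) (by simp)).mp this
  calc ‖T‖ * ‖T‖ ≤ √‖star T * T‖ * √‖star T * T‖ := by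
        gcongr <;> exact key
    _ = _ := Real.mul_self_sqrt (norm_nonneg _)

instance : CStarRing (Adjointable C E) where
  norm_mul_self_le := norm_star_mul_self_ge

theorem isClosed_adjointable [CompleteSpace E] :
    IsClosed (adjointable C E : Set (E →L[ℂ] E)) := by
  refine isClosed_of_closure_subset fun T hT => ?_
  obtain ⟨u, hu, hlim⟩ := mem_closure_iff_seq_limit.mp hT
  choose v hv using hu
  have hc : CauchySeq v := by
    have := hlim.cauchySeq
    rw [Metric.cauchySeq_iff] at this ⊢
    intro ε hε
    obtain ⟨N, hN⟩ := this ε hε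
    refine ⟨N, fun m hm n hn => lt_of_le_of_lt ?_ (hN m hm n hn)⟩
    rw [dist_eq_norm, dist_eq_norm]
    exact norm_adjoint_le (C := C) fun x y => by simp [hv]
  obtain ⟨T', hT'⟩ := cauchySeq_tendsto_of_complete hc
  refine ⟨T', fun x y => ?_⟩
  have h1 : Filter.Tendsto (fun n => inner C (u n x) y) Filter.atTop (nhds (inner C (T x) y)) :=
    (CStarModule.continuous_inner (A := C) (E := E)).continuousAt.tendsto.comp
      ((((ContinuousLinearMap.apply ℂ E x).continuous.tendsto T).comp hlim).prodMk_nhds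
        tendsto_const_nhds)
  have h2 : Filter.Tendsto (fun n => inner C x (v n y)) Filter.atTop (nhds (inner C x (T' y))) :=
    (CStarModule.continuous_inner (A := C) (E := E)).continuousAt.tendsto.comp
      (tendsto_const_nhds.prodMk_nhds
        (((ContinuousLinearMap.apply ℂ E y).continuous.tendsto T').comp hT'))
  exact tendsto_nhds_unique h1 (by simpa only [hv] using h2)

instance [CompleteSpace E] : CompleteSpace (Adjointable C E) :=
  (isClosed_adjointable (C := C) (E := E)).completeSpace_coe

/-- `𝓛(E)` is a (unital) C*-algebra. -/
noncomputable instance [CompleteSpace E] : CStarAlgebra (Adjointable C E) where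

theorem exists_algebraMap_sub_eq {D : Type*} [CStarAlgebra D] {a : D} (ha : IsSelfAdjoint a)
    {k : ℝ} (hk : ‖a‖ ≤ k) : ∃ q : D, algebraMap ℝ D k - a = star q * q := by
  let _ : PartialOrder D := CStarAlgebra.spectralOrder _
  have _ : StarOrderedRing D := CStarAlgebra.spectralOrderedRing _
  exact CStarAlgebra.nonneg_iff_eq_star_mul_self.mp
    (sub_nonneg.mpr (ha.le_algebraMap_norm_self.trans (algebraMap_mono _ hk)))

/-- For an adjointable operator `T : E → F` one has `⟪Tx, Tx⟫ ≤ ‖T‖² ⟪x, x⟫`. -/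
theorem inner_map_self_le [CompleteSpace E] {T : E →L[ℂ] F} {T' : F →L[ℂ] E}
    (h : ∀ x y, inner C (T x) y = inner C x (T' y)) (x : E) :
    inner C (T x) (T x) ≤ (‖T‖ ^ 2) • inner C x x := by
  have h' : ∀ x y, inner C (T' x) y = inner C x (T y) := fun x y => by
    rw [← CStarModule.star_inner, ← h, CStarModule.star_inner]
  let R : Adjointable C E := ⟨T' ∘L T, T' ∘L T, fun x y => by simp [h, h']⟩
  have hR : IsSelfAdjoint R := star_eq_of fun x y => by
    change inner C (T' (T x)) y = inner C x (T' (T y))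
    rw [h', h]
  have h1 : ‖R‖ ≤ ‖T‖ ^ 2 := by
    calc ‖R‖ ≤ ‖T'‖ * ‖T‖ := ContinuousLinearMap.opNorm_comp_le _ _
      _ ≤ ‖T‖ * ‖T‖ := by gcongr; exact norm_adjoint_le h
      _ = ‖T‖ ^ 2 := by ring
  obtain ⟨Q, hQ⟩ := exists_algebraMap_sub_eq hR h1
  have h2 : inner C x ((algebraMap ℝ (Adjointable C E) (‖T‖ ^ 2) - R) x) = inner C (Q x) (Q x) := by
    rw [hQ, ← inner_star_right]; rfl
  have h3 : (algebraMap ℝ (Adjointable C E) (‖T‖ ^ 2) - R) x = (‖T‖ ^ 2) • x - T' (T x) := by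
    rw [Algebra.algebraMap_eq_smul_one]; rfl
  rw [h3, CStarModule.inner_sub_right, CStarModule.inner_smul_right_real, ← h] at h2
  rw [← sub_nonneg, h2]
  exact CStarModule.inner_self_nonneg

/-- Existence of adjoints may be checked on a set with dense span. -/
theorem exists_adjoint_of_dense [CompleteSpace E] (T : E →L[ℂ] F) (D : Set F)
    (hD : (Submodule.span ℂ D).topologicalClosure = ⊤)
    (h : ∀ x ∈ D, ∃ y : E, ∀ z, inner C (T z) x = inner C z y) :
    ∃ T' : F →L[ℂ] E, ∀ x y, inner C (T x) y = inner C x (T' y) := by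
  have bd : ∀ (x : F) (y : E), (∀ z, inner C (T z) x = inner C z y) → ‖y‖ ≤ ‖T‖ * ‖x‖ := by
    intro x y hxy
    have h1 : ‖y‖ * ‖y‖ ≤ ‖T‖ * ‖x‖ * ‖y‖ := by
      rw [← pow_two, CStarModule.norm_sq_eq (A := C), ← hxy]
      calc ‖inner C (T y) x‖ ≤ ‖T y‖ * ‖x‖ := CStarModule.norm_inner_le F
        _ ≤ ‖T‖ * ‖y‖ * ‖x‖ := by gcongr; exact T.le_opNorm _
        _ = ‖T‖ * ‖x‖ * ‖y‖ := by ring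
    rcases (norm_nonneg y).eq_or_lt with h0 | h0
    · rw [← h0]; positivity
    · exact le_of_mul_le_mul_right h1 h0
  let P : Submodule ℂ F :=
    { carrier := {x | ∃ y : E, ∀ z, inner C (T z) x = inner C z y}
      add_mem' := by
        rintro x x' ⟨y, hy⟩ ⟨y', hy'⟩
        exact ⟨y + y', fun z => by simp [hy, hy']⟩
      zero_mem' := ⟨0, fun z => by simp⟩
      smul_mem' := by
        rintro k x ⟨y, hy⟩
        exact ⟨k • y, fun z => by simp [hy]⟩ }
  have hP : IsClosed (P : Set F) := by
    refine isClosed_of_closure_subset fun x hx => ?_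
    obtain ⟨u, hu, hlim⟩ := mem_closure_iff_seq_limit.mp hx
    choose v hv using hu
    have hc : CauchySeq v := by
      have h1 := hlim.cauchySeq
      rw [Metric.cauchySeq_iff] at h1 ⊢
      intro ε hε
      obtain ⟨N, hN⟩ := h1 (ε / (‖T‖ + 1)) (by positivity)
      refine ⟨N, fun m hm n hn => ?_⟩
      have h2 := hN m hm n hn
      rw [dist_eq_norm] at h2 ⊢
      have h3 := bd (u m - u n) (v m - v n) fun z => by simp [hv]
      have h4 : ‖T‖ * ‖u m - u n‖ ≤ (‖T‖ + 1) * ‖u m - u n‖ := by gcongr; linarith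
      rw [lt_div_iff₀ (by positivity), mul_comm] at h2
      linarith
    obtain ⟨y, hy⟩ := cauchySeq_tendsto_of_complete hc
    refine ⟨y, fun z => ?_⟩
    have h1 : Filter.Tendsto (fun n => inner C (T z) (u n)) Filter.atTop
        (nhds (inner C (T z) x)) :=
      (CStarModule.continuous_inner (A := C) (E := F)).continuousAt.tendsto.comp
        (tendsto_const_nhds.prodMk_nhds hlim)
    have h2 : Filter.Tendsto (fun n => inner C z (v n)) Filter.atTop (nhds (inner C z y)) :=
      (CStarModule.continuous_inner (A := C) (E := E)).continuousAt.tendsto.comp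
        (tendsto_const_nhds.prodMk_nhds hy)
    exact tendsto_nhds_unique h1 (by simpa only [hv] using h2)
  have hall : ∀ x : F, ∃ y : E, ∀ z, inner C (T z) x = inner C z y := by
    have h1 : (Submodule.span ℂ D).topologicalClosure ≤ P :=
      Submodule.topologicalClosure_minimal _ (Submodule.span_le.mpr h) hP
    rw [hD] at h1
    exact fun x => h1 Submodule.mem_top
  choose T' hT' using hall
  refine ⟨LinearMap.mkContinuous
    { toFun := T'
      map_add' := fun x y => ext_inner_left C fun z => by
        simp [CStarModule.inner_add_right, ← hT']
      map_smul' := fun k x => ext_inner_left C fun z => by simp [← hT'] } ‖T‖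
    fun x => bd x _ (hT' x), fun x y => hT' y x⟩

/-- The rank one operator `Θ_{ξ,η} : μ ↦ ξ · ⟨η, μ⟩`. -/
noncomputable def rankOne (ξ η : E) : Adjointable C E :=
  have bd : ∀ ξ η μ : E, ‖(inner C η μ : C) • ξ‖ ≤ ‖ξ‖ * ‖η‖ * ‖μ‖ := fun ξ η μ =>
    (norm_act_le _ _).trans <| by
      calc _ ≤ ‖η‖ * ‖μ‖ * ‖ξ‖ := by gcongr; exact CStarModule.norm_inner_le E
        _ = _ := by ring
  let θ : E → E → (E →L[ℂ] E) := fun ξ η => LinearMap.mkContinuous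
    { toFun := fun μ => (inner C η μ : C) • ξ
      map_add' := fun μ ν => by rw [CStarModule.inner_add_right, add_act]
      map_smul' := fun k μ => by
        rw [CStarModule.inner_smul_right_complex, smul_act, RingHom.id_apply] }
    (‖ξ‖ * ‖η‖) (bd ξ η)
  ⟨θ ξ η, θ η ξ, fun x y => by simp [θ]⟩

@[simp] theorem rankOne_apply (ξ η μ : E) :
    (rankOne ξ η : Adjointable C E) μ = (inner C η μ : C) • ξ := rfl

variable (C E) in
/-- The generalised compact operators `𝓚(E)`: the closed linear span of the `Θ_{ξ,η}`. -/
noncomputable def compacts : Submodule ℂ (Adjointable C E) :=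
  (Submodule.span ℂ {T | ∃ ξ η : E, T = rankOne ξ η}).topologicalClosure

theorem rankOne_mem_compacts (ξ η : E) : (rankOne ξ η : Adjointable C E) ∈ compacts C E :=
  Submodule.le_topologicalClosure _ (Submodule.subset_span ⟨ξ, η, rfl⟩)

end Basic

/-! ### Hilbert direct sums -/

section Sum

variable {C : Type*} [NonUnitalCStarAlgebra C] [PartialOrder C] [StarOrderedRing C]

theorem summable_of_nonneg_of_le {ι : Type*} {f g : ι → C} (h0 : ∀ i, 0 ≤ f i)
    (h : ∀ i, f i ≤ g i) (hg : Summable g) : Summable f := by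
  rw [summable_iff_vanishing_norm] at hg ⊢
  intro ε hε
  obtain ⟨s, hs⟩ := hg ε hε
  refine ⟨s, fun t ht => lt_of_le_of_lt ?_ (hs t ht)⟩
  exact CStarAlgebra.norm_le_norm_of_nonneg_of_le (Finset.sum_nonneg fun i _ => h0 i)
    (Finset.sum_le_sum fun i _ => h i)

variable {ι : Type*} {E : ι → Type*} [∀ i, NormedAddCommGroup (E i)] [∀ i, NormedSpace ℂ (E i)]
  [∀ i, SMul C (E i)] [∀ i, CStarModule C (E i)]

theorem summable_inner_self_add {x y : ∀ i, E i} (hx : Summable fun i => inner C (x i) (x i))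
    (hy : Summable fun i => inner C (y i) (y i)) :
    Summable fun i => inner C (x i + y i) (x i + y i) := by
  refine summable_of_nonneg_of_le (fun i => CStarModule.inner_self_nonneg) (fun i => ?_)
    ((hx.add hy).add (hx.add hy))
  rw [← sub_nonneg]
  have h : (0 : C) ≤ inner C (x i - y i) (x i - y i) := CStarModule.inner_self_nonneg
  convert h using 1
  simp only [CStarModule.inner_add_left, CStarModule.inner_add_right, CStarModule.inner_sub_left,
    CStarModule.inner_sub_right]
  abel

theorem summable_inner_self_smul {x : ∀ i, E i} (k : ℂ)
    (hx : Summable fun i => inner C (x i) (x i)) :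
    Summable fun i => inner C (k • x i) (k • x i) := by
  simp only [CStarModule.inner_smul_left_complex, CStarModule.inner_smul_right_complex]
  exact (hx.const_smul (star k)).const_smul k

theorem summable_inner_self_act {x : ∀ i, E i} (c : C)
    (hx : Summable fun i => inner C (x i) (x i)) :
    Summable fun i => inner C (c • x i) (c • x i) := by
  simp only [CStarModule.inner_op_smul_left, CStarModule.inner_op_smul_right]
  exact (hx.mul_right (star c)).mul_left c

theorem summable_inner {x y : ∀ i, E i} (hx : Summable fun i => inner C (x i) (x i))
    (hy : Summable fun i => inner C (y i) (y i)) : Summable fun i => inner C (x i) (y i) := by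
  have h1 := summable_inner_self_add hx hy
  have h2 := summable_inner_self_add hx (summable_inner_self_smul Complex.I hy)
  have h3 := (((h1.sub hx).sub hy).sub
    (((h2.sub hx).sub (summable_inner_self_smul Complex.I hy)).const_smul Complex.I)).const_smul
      (1 / 2 : ℂ)
  refine h3.congr fun i => ?_
  simp only [CStarModule.inner_add_left, CStarModule.inner_add_right,
    CStarModule.inner_smul_left_complex, CStarModule.inner_smul_right_complex, smul_add, smul_sub,
    smul_smul]
  match_scalars <;> ring_nf <;> simp <;> ring

variable (C E) in
/-- The families `(x_i)` for which `∑ ⟪x_i, x_i⟫` converges (unconditionally, in norm) in `C`. -/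
def hilbertSumSubmodule : Submodule ℂ (∀ i, E i) where
  carrier := {x | Summable fun i => inner C (x i) (x i)}
  add_mem' := summable_inner_self_add
  zero_mem' := by simp
  smul_mem' k _ hx := summable_inner_self_smul k hx

variable (C E) in
/-- The Hilbert module direct sum of the `E i`: the families `(x_i)` with `∑ ⟪x_i, x_i⟫` convergent,
with coordinatewise operations and `⟪x, y⟫ = ∑ ⟪x_i, y_i⟫`. -/
def HilbertSum : Type _ := hilbertSumSubmodule C E

namespace HilbertSum

instance : AddCommGroup (HilbertSum C E) := inferInstanceAs (AddCommGroup (hilbertSumSubmodule C E))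

instance : Module ℂ (HilbertSum C E) := inferInstanceAs (Module ℂ (hilbertSumSubmodule C E))

instance : CoeFun (HilbertSum C E) (fun _ => ∀ i, E i) := ⟨fun x => x.1⟩

@[ext] theorem ext {x y : HilbertSum C E} (h : ∀ i, x i = y i) : x = y := Subtype.ext (funext h)

instance : SMul C (HilbertSum C E) := ⟨fun c x => ⟨fun i => c • x i, summable_inner_self_act c x.2⟩⟩

@[simp] theorem add_apply (x y : HilbertSum C E) (i : ι) : (x + y) i = x i + y i := rfl

@[simp] theorem sub_apply (x y : HilbertSum C E) (i : ι) : (x - y) i = x i - y i := rfl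

@[simp] theorem zero_apply (i : ι) : (0 : HilbertSum C E) i = 0 := rfl

@[simp] theorem smul_apply (k : ℂ) (x : HilbertSum C E) (i : ι) : (k • x) i = k • x i := rfl

@[simp] theorem act_apply (c : C) (x : HilbertSum C E) (i : ι) : (c • x) i = c • x i := rfl

theorem summable (x y : HilbertSum C E) : Summable fun i => inner C (x i) (y i) :=
  summable_inner x.2 y.2

theorem sum_le_tsum_inner (x : HilbertSum C E) (s : Finset ι) :
    ∑ i ∈ s, inner C (x i) (x i) ≤ ∑' i, inner C (x i) (x i) :=
  x.2.sum_le_tsum s fun _ _ => CStarModule.inner_self_nonneg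

noncomputable instance : Norm (HilbertSum C E) :=
  ⟨fun x => √‖∑' i, inner C (x i) (x i)‖⟩

/-- The Hilbert module structure of the direct sum, with `⟪x, y⟫ = ∑ ⟪x_i, y_i⟫`. -/
noncomputable abbrev cstarModuleCore : CStarModule C (HilbertSum C E) where
  inner x y := ∑' i, inner C (x i) (y i)
  inner_add_right {x y z} := by
    simp only [add_apply, CStarModule.inner_add_right]
    exact (summable x y).tsum_add (summable x z)
  inner_self_nonneg {x} := tsum_nonneg fun i => CStarModule.inner_self_nonneg
  inner_self {x} := by
    refine ⟨fun h => ext fun i => ?_, fun h => by simp [h]⟩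
    have h1 := sum_le_tsum_inner x {i}
    rw [h, Finset.sum_singleton] at h1
    exact (CStarModule.inner_self (A := C)).mp (le_antisymm h1 CStarModule.inner_self_nonneg)
  inner_op_smul_right {c x y} := by
    simp only [act_apply, CStarModule.inner_op_smul_right]
    exact (summable x y).tsum_mul_left c
  inner_smul_right_complex {k x y} := by
    simp only [smul_apply, CStarModule.inner_smul_right_complex]
    exact (summable x y).tsum_const_smul k
  star_inner x y := by
    simp only [tsum_star, CStarModule.star_inner]
  norm_eq_sqrt_norm_inner_self _ := rfl

noncomputable instance : NormedAddCommGroup (HilbertSum C E) :=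
  letI := cstarModuleCore (C := C) (E := E)
  CStarModule.normedAddCommGroup C

noncomputable instance : NormedSpace ℂ (HilbertSum C E) :=
  letI := cstarModuleCore (C := C) (E := E)
  .ofCore (CStarModule.normedSpaceCore C)

noncomputable instance : CStarModule C (HilbertSum C E) := cstarModuleCore

theorem inner_def (x y : HilbertSum C E) : inner C x y = ∑' i, inner C (x i) (y i) := rfl

theorem inner_apply_le (x : HilbertSum C E) (s : Finset ι) :
    ∑ i ∈ s, inner C (x i) (x i) ≤ inner C x x := sum_le_tsum_inner x s

theorem norm_sum_le (x : HilbertSum C E) (s : Finset ι) :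
    ‖∑ i ∈ s, inner C (x i) (x i)‖ ≤ ‖x‖ ^ 2 := by
  rw [CStarModule.norm_sq_eq (A := C)]
  exact CStarAlgebra.norm_le_norm_of_nonneg_of_le
    (Finset.sum_nonneg fun i _ => CStarModule.inner_self_nonneg) (inner_apply_le x s)

theorem norm_apply_le (x : HilbertSum C E) (i : ι) : ‖x i‖ ≤ ‖x‖ := by
  have h := norm_sum_le x {i}
  rw [Finset.sum_singleton, ← CStarModule.norm_sq_eq (A := C)] at h
  exact (pow_le_pow_iff_left₀ (norm_nonneg _) (norm_nonneg _) (by simp)).mp h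

open Classical in
/-- The truncation of an arbitrary family to a finite set of indices. -/
noncomputable def trunc (s : Finset ι) (x : ∀ i, E i) : HilbertSum C E :=
  ⟨fun i => if i ∈ s then x i else 0,
    summable_of_ne_finset_zero (s := s) fun i hi => by simp [hi]⟩

theorem trunc_sub (s : Finset ι) (x y : ∀ i, E i) :
    (trunc s (x - y) : HilbertSum C E) = trunc s x - trunc s y := by
  ext i
  rw [sub_apply]
  by_cases h : i ∈ s <;> simp [trunc, h]

theorem norm_trunc_sq (s : Finset ι) (x : ∀ i, E i) :
    ‖(trunc s x : HilbertSum C E)‖ ^ 2 = ‖∑ i ∈ s, inner C (x i) (x i)‖ := by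
  rw [CStarModule.norm_sq_eq (A := C), inner_def, tsum_eq_sum (s := s)]
  · congr 1
    exact Finset.sum_congr rfl fun i hi => by simp [trunc, hi]
  · intro i hi
    simp [trunc, hi]

theorem norm_trunc_le (s : Finset ι) (x : HilbertSum C E) :
    ‖(trunc s x.1 : HilbertSum C E)‖ ≤ ‖x‖ := by
  have h := norm_sum_le x s
  rw [← norm_trunc_sq] at h
  exact (pow_le_pow_iff_left₀ (norm_nonneg _) (norm_nonneg _) (by simp)).mp h

instance [∀ i, CompleteSpace (E i)] : CompleteSpace (HilbertSum C E) := by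
  refine Metric.complete_of_cauchySeq_tendsto fun u hu => ?_
  rw [Metric.cauchySeq_iff] at hu
  have hcoord : ∀ i, ∃ z : E i, Filter.Tendsto (fun n => u n i) Filter.atTop (nhds z) := by
    intro i
    refine cauchySeq_tendsto_of_complete (Metric.cauchySeq_iff.mpr fun ε hε => ?_)
    obtain ⟨N, hN⟩ := hu ε hε
    refine ⟨N, fun m hm n hn => lt_of_le_of_lt ?_ (hN m hm n hn)⟩
    rw [dist_eq_norm, dist_eq_norm]
    exact norm_apply_le (u m - u n) i
  choose z hz using hcoord
  have key : ∀ ε > 0, ∃ N, ∀ n ≥ N, ∀ s : Finset ι,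
      ‖(trunc s (z - (u n).1) : HilbertSum C E)‖ ≤ ε := by
    intro ε hε
    obtain ⟨N, hN⟩ := hu ε hε
    refine ⟨N, fun n hn s => ?_⟩
    have h1 : ∀ m ≥ N, ‖∑ i ∈ s, inner C ((u m - u n) i) ((u m - u n) i)‖ ≤ ε ^ 2 := by
      intro m hm
      refine (norm_sum_le _ s).trans ?_
      have := (hN m hm n hn).le
      rw [dist_eq_norm] at this
      gcongr
    have h2 : Filter.Tendsto (fun m => ‖∑ i ∈ s, inner C ((u m - u n) i) ((u m - u n) i)‖)
        Filter.atTop (nhds ‖∑ i ∈ s, inner C ((z - (u n).1) i) ((z - (u n).1) i)‖) := by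
      refine (tendsto_finsetSum _ fun i _ => ?_).norm
      have h3 : Filter.Tendsto (fun m => (u m - u n) i) Filter.atTop
          (nhds ((z - (u n).1) i)) := (hz i).sub tendsto_const_nhds
      exact (CStarModule.continuous_inner (A := C) (E := E i)).continuousAt.tendsto.comp
        (h3.prodMk_nhds h3)
    have h4 := le_of_tendsto h2 (Filter.eventually_atTop.mpr ⟨N, h1⟩)
    rw [← norm_trunc_sq] at h4
    exact (pow_le_pow_iff_left₀ (norm_nonneg _) hε.le (by simp)).mp h4
  have hmem : Summable fun i => inner C (z i) (z i) := by
    rw [summable_iff_vanishing_norm]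
    intro ε hε
    have hε' : 0 < √ε / 2 := by positivity
    obtain ⟨N, hN⟩ := key (√ε / 4) (by positivity)
    obtain ⟨s, hs⟩ := summable_iff_vanishing_norm.mp (u N).2 ((√ε / 2) ^ 2) (by positivity)
    refine ⟨s, fun t ht => ?_⟩
    have h1 := hs t ht
    rw [← norm_trunc_sq] at h1 ⊢
    have h2 : ‖(trunc t (u N).1 : HilbertSum C E)‖ < √ε / 2 :=
      lt_of_pow_lt_pow_left₀ 2 hε'.le h1
    have h3 := hN N le_rfl t
    rw [trunc_sub] at h3
    have h4 : ‖(trunc t z : HilbertSum C E)‖ < √ε := by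
      have := norm_le_norm_sub_add (trunc t z : HilbertSum C E) (trunc t (u N).1)
      linarith
    calc ‖(trunc t z : HilbertSum C E)‖ ^ 2 < √ε ^ 2 := by gcongr
      _ = ε := Real.sq_sqrt hε.le
  let w : HilbertSum C E := ⟨z, hmem⟩
  refine ⟨w, Metric.tendsto_atTop.mpr fun ε hε => ?_⟩
  obtain ⟨N, hN⟩ := key (ε / 2) (by positivity)
  refine ⟨N, fun n hn => lt_of_le_of_lt ?_ (half_lt_self hε)⟩
  rw [dist_comm, dist_eq_norm]
  have h1 : Filter.Tendsto (fun s : Finset ι => ‖∑ i ∈ s, inner C ((z - (u n).1) i)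
      ((z - (u n).1) i)‖) Filter.atTop (nhds (‖w - u n‖ ^ 2)) := by
    rw [CStarModule.norm_sq_eq (A := C)]
    exact ((w - u n).2.hasSum).norm
  have h2 := le_of_tendsto h1 (Filter.Eventually.of_forall fun s => by
    rw [← norm_trunc_sq]
    exact pow_le_pow_left₀ (norm_nonneg _) (hN n hn s) 2)
  exact (pow_le_pow_iff_left₀ (norm_nonneg _) (by positivity) (by simp)).mp h2

end HilbertSum

end Sum

end HilbertMod

/-! ### Product systems over right LCM semigroups -/

universe u v w

/-- The principal right ideal `pS`. -/
def principalRightIdeal {S : Type*} [Monoid S] (p : S) : Set S := Set.range fun s => p * s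

/-- A right LCM semigroup (with identity): a left cancellative monoid in which the intersection of
two principal right ideals is either empty or again a principal right ideal. -/
class IsRightLCM (S : Type*) [Monoid S] : Prop extends IsLeftCancelMul S where
  inter_eq (p q : S) : principalRightIdeal p ∩ principalRightIdeal q = ∅ ∨
    ∃ r, principalRightIdeal p ∩ principalRightIdeal q = principalRightIdeal r

open HilbertMod

/-- The `A`-valued inner product of a right Hilbert `A`-module. -/
def rinner (A : Type*) {E : Type*} [Inner Aᵐᵒᵖ E] (x y : E) : A :=
  MulOpposite.unop (inner Aᵐᵒᵖ x y)

/-- A product system of right Hilbert `A`-bimodules over the monoid `S`.  Each fibre is a right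
Hilbert `A`-module with a left action of `A` by adjointable operators.  The multiplication
`M_p × M_q → M_{pq}` is written `mul h` with `h : p * q = r`, which avoids transporting elements
along equalities in `S`.  For `p ≠ 1` the map `x ⊗ y ↦ xy` is an isomorphism of
`M_p ⊗_A M_q` (the completion of the algebraic tensor product for the inner product
`⟨x ⊗ y, x' ⊗ y'⟩ = ⟨y, ⟨x, x'⟩ y'⟩`) onto `M_{pq}`: it preserves inner products and has dense
range.  The fibre `M_1` is `A` as a bimodule over itself, and multiplication by elements of `M_1` is
given by the module actions; in particular multiplication is a bimodule map. -/
structure ProductSystem (A : Type u) [NonUnitalCStarAlgebra A] [PartialOrder A] [StarOrderedRing A]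
    (S : Type v) [Monoid S] where
  /-- the fibres `M_p` -/
  fiber : S → Type w
  [normedAddCommGroup : ∀ p, NormedAddCommGroup (fiber p)]
  [normedSpace : ∀ p, NormedSpace ℂ (fiber p)]
  [completeSpace : ∀ p, CompleteSpace (fiber p)]
  [rightAction : ∀ p, SMul Aᵐᵒᵖ (fiber p)]
  [cstarModule : ∀ p, CStarModule Aᵐᵒᵖ (fiber p)]
  /-- the left action `φ_p : A → 𝓛(M_p)` -/
  left : ∀ p, A →⋆ₙₐ[ℂ] Adjointable Aᵐᵒᵖ (fiber p)
  /-- the multiplication `M_p × M_q → M_{pq}` -/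
  mul : ∀ {p q r : S}, p * q = r → fiber p →ₗ[ℂ] fiber q →ₗ[ℂ] fiber r
  assoc : ∀ {p q s pq qs t : S} (h₁ : p * q = pq) (h₂ : pq * s = t) (h₃ : q * s = qs)
    (h₄ : p * qs = t) (x : fiber p) (y : fiber q) (z : fiber s),
    mul h₂ (mul h₁ x y) z = mul h₄ x (mul h₃ y z)
  rinner_mul : ∀ {p q r : S} (h : p * q = r), p ≠ 1 → ∀ (x x' : fiber p) (y y' : fiber q),
    rinner A (mul h x y) (mul h x' y') = rinner A y (left q (rinner A x x') y')
  dense_mul : ∀ {p q r : S} (h : p * q = r), p ≠ 1 →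
    (Submodule.span ℂ {z : fiber r | ∃ x y, z = mul h x y}).topologicalClosure = ⊤
  /-- the identification `M_1 = A` -/
  unit : fiber 1 ≃ₗ[ℂ] A
  rinner_unit : ∀ x y : fiber 1, rinner A x y = star (unit x) * unit y
  unit_right : ∀ (x : fiber 1) (a : A), unit (MulOpposite.op a • x) = unit x * a
  unit_left : ∀ (x : fiber 1) (a : A), unit (left 1 a x) = a * unit x
  unit_mul : ∀ {p : S} (h : 1 * p = p) (a : fiber 1) (x : fiber p),
    mul h a x = left p (unit a) x
  mul_unit : ∀ {p : S} (h : p * 1 = p) (x : fiber p) (a : fiber 1),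
    mul h x a = MulOpposite.op (unit a) • x

attribute [instance] ProductSystem.normedAddCommGroup ProductSystem.normedSpace
  ProductSystem.completeSpace ProductSystem.rightAction ProductSystem.cstarModule

namespace ProductSystem

variable {A : Type u} [NonUnitalCStarAlgebra A] [PartialOrder A] [StarOrderedRing A]
  {S : Type v} [Monoid S] (M : ProductSystem.{u, v, w} A S)

/-! #### Compact alignment -/

/-- `R ∈ 𝓛(M_r)` is `T ⊗ id` for `T ∈ 𝓛(M_p)`, where `r = pq`: one has `R(ξη) = (Tξ)η` for all
`ξ ∈ M_p`, `η ∈ M_q`.  For `p ≠ 1` this determines `R`, because the products `ξη` span a dense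
subspace.  The left action of `A` on `M_r` may be degenerate, so that products of elements of `M_1`
and `M_r` need not span a dense subspace; for `p = 1`, where `𝓚(M_1) = A` consists of the left
multiplications by elements of `A`, the usual convention is that left multiplication by `a` is
sent to `φ_r(a)`. -/
def IsTensorId {p r : S} (T : Adjointable Aᵐᵒᵖ (M.fiber p))
    (R : Adjointable Aᵐᵒᵖ (M.fiber r)) : Prop :=
  ∃ (q : S) (h : p * q = r),
    (∀ (ξ : M.fiber p) (η : M.fiber q), R (M.mul h ξ η) = M.mul h (T ξ) η) ∧
    (p = 1 → ∀ a : A, T = M.left p a → R = M.left r a)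

open Classical in
/-- The homomorphism `ι_p^r : 𝓛(M_p) → 𝓛(M_r)`, `T ↦ T ⊗ id`, for `r ∈ pS`; for `r ∉ pS` it is
zero. -/
noncomputable def iota (p r : S) (T : Adjointable Aᵐᵒᵖ (M.fiber p)) :
    Adjointable Aᵐᵒᵖ (M.fiber r) :=
  if h : ∃ R, M.IsTensorId T R then h.choose else 0

/-- `M` is compactly aligned: `ι_p^r(T_p) ι_q^r(T_q)` is compact whenever `pS ∩ qS = rS` and `T_p`,
`T_q` are compact. -/
def CompactlyAligned : Prop :=
  ∀ p q r : S, principalRightIdeal p ∩ principalRightIdeal q = principalRightIdeal r →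
    ∀ T ∈ compacts Aᵐᵒᵖ (M.fiber p), ∀ T' ∈ compacts Aᵐᵒᵖ (M.fiber q),
      M.iota p r T * M.iota q r T' ∈ compacts Aᵐᵒᵖ (M.fiber r)

/-! #### Representations and Nica covariance -/

/-- A representation of the product system `M` in a C*-algebra `B`. -/
structure Representation (B : Type*) [NonUnitalCStarAlgebra B] where
  /-- the linear maps `ψ_p : M_p → B` -/
  toFun : ∀ p, M.fiber p →ₗ[ℂ] B
  map_mul : ∀ {p q r : S} (h : p * q = r) (ξ : M.fiber p) (η : M.fiber q),
    toFun p ξ * toFun q η = toFun r (M.mul h ξ η)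
  map_star : ∀ a : A, toFun 1 (M.unit.symm (star a)) = star (toFun 1 (M.unit.symm a))
  map_rinner : ∀ (p : S) (ξ η : M.fiber p),
    star (toFun p ξ) * toFun p η = toFun 1 (M.unit.symm (rinner A ξ η))

variable {M}

open Classical in
/-- The homomorphism `ψ^{(p)} : 𝓚(M_p) → B`, which is the bounded linear map characterised by
`ψ^{(p)}(Θ_{ξ,η}) = ψ_p(ξ) ψ_p(η)*`. -/
noncomputable def Representation.onCompacts {B : Type*} [NonUnitalCStarAlgebra B]
    (ψ : M.Representation B) (p : S) : compacts Aᵐᵒᵖ (M.fiber p) →L[ℂ] B :=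
  if h : ∃ Ψ : compacts Aᵐᵒᵖ (M.fiber p) →L[ℂ] B, ∀ ξ η : M.fiber p,
      Ψ ⟨rankOne ξ η, rankOne_mem_compacts ξ η⟩ = ψ.toFun p ξ * star (ψ.toFun p η)
  then h.choose else 0

/-- A representation of a compactly aligned product system is Nica covariant if
`ψ^{(p)}(T_p) ψ^{(q)}(T_q)` equals `ψ^{(r)}(ι_p^r(T_p) ι_q^r(T_q))` whenever `pS ∩ qS = rS`, and
vanishes if `pS ∩ qS` is not a principal right ideal. -/
def Representation.NicaCovariant {B : Type*} [NonUnitalCStarAlgebra B]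
    (ψ : M.Representation B) (hM : M.CompactlyAligned) : Prop :=
  ∀ (p q : S) (T : compacts Aᵐᵒᵖ (M.fiber p)) (T' : compacts Aᵐᵒᵖ (M.fiber q)),
    (∀ (r : S) (hr : principalRightIdeal p ∩ principalRightIdeal q = principalRightIdeal r),
      ψ.onCompacts p T * ψ.onCompacts q T' =
        ψ.onCompacts r ⟨M.iota p r T * M.iota q r T', hM p q r hr T T.2 T' T'.2⟩) ∧
    ((¬ ∃ r, principalRightIdeal p ∩ principalRightIdeal q = principalRightIdeal r) →
      ψ.onCompacts p T * ψ.onCompacts q T' = 0)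

/-- `(N, j)` is the Nica-Toeplitz algebra of the compactly aligned product system `M`: the universal
C*-algebra generated by a Nica covariant representation of `M`. -/
structure IsNicaToeplitz (hM : M.CompactlyAligned) {N : Type*} [NonUnitalCStarAlgebra N]
    (j : M.Representation N) : Prop where
  nicaCovariant : j.NicaCovariant hM
  generates : (NonUnitalStarAlgebra.adjoin ℂ
    {b : N | ∃ (p : S) (ξ : M.fiber p), b = j.toFun p ξ}).topologicalClosure = ⊤
  universal : ∀ (B : Type (max v w)) [NonUnitalCStarAlgebra B] (ψ : M.Representation B),
    ψ.NicaCovariant hM →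
      ∃ Φ : N →⋆ₙₐ[ℂ] B, ∀ (p : S) (ξ : M.fiber p), Φ (j.toFun p ξ) = ψ.toFun p ξ

/-! #### The Fock representation -/

theorem op_rinner {E : Type*} [Inner Aᵐᵒᵖ E] (x y : E) :
    MulOpposite.op (rinner A x y) = inner Aᵐᵒᵖ x y := rfl

theorem inner_mul {p q r : S} (h : p * q = r) (x x' : M.fiber p) (y y' : M.fiber q) :
    inner Aᵐᵒᵖ (M.mul h x y) (M.mul h x' y') =
      inner Aᵐᵒᵖ y (M.left q (rinner A x x') y') := by
  by_cases hp : p = 1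
  · subst hp
    obtain rfl : q = r := by simpa using h
    rw [M.unit_mul, M.unit_mul, M.rinner_unit, map_mul, map_star, ← inner_star_right]
    rfl
  · exact MulOpposite.unop_injective (M.rinner_mul h hp x x' y y')

theorem norm_rinner_self {E : Type*} [NormedAddCommGroup E] [NormedSpace ℂ E] [SMul Aᵐᵒᵖ E]
    [CStarModule Aᵐᵒᵖ E] (x : E) : ‖rinner A x x‖ = ‖x‖ ^ 2 := by
  rw [CStarModule.norm_sq_eq (A := Aᵐᵒᵖ)]; rfl

theorem norm_mul_apply_le {p q r : S} (h : p * q = r) (x : M.fiber p) (y : M.fiber q) :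
    ‖M.mul h x y‖ ≤ ‖x‖ * ‖y‖ := by
  have h1 : ‖M.mul h x y‖ ^ 2 ≤ (‖x‖ * ‖y‖) ^ 2 := by
    rw [CStarModule.norm_sq_eq (A := Aᵐᵒᵖ), inner_mul]
    calc _ ≤ ‖y‖ * ‖M.left q (rinner A x x) y‖ := CStarModule.norm_inner_le _
      _ ≤ ‖y‖ * (‖M.left q (rinner A x x)‖ * ‖y‖) := by
          gcongr; exact (M.left q (rinner A x x)).1.le_opNorm y
      _ ≤ ‖y‖ * (‖rinner A x x‖ * ‖y‖) := by
          gcongr; exact NonUnitalStarAlgHom.norm_apply_le _ _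
      _ = (‖x‖ * ‖y‖) ^ 2 := by rw [norm_rinner_self]; ring
  exact (pow_le_pow_iff_left₀ (norm_nonneg _) (by positivity) (by simp)).mp h1

/-- Left multiplication by `ξ ∈ M_p`, as a bounded operator `M_q → M_{pq}`. -/
noncomputable def creation {p q r : S} (h : p * q = r) (ξ : M.fiber p) :
    M.fiber q →L[ℂ] M.fiber r :=
  (M.mul h ξ).mkContinuous ‖ξ‖ (norm_mul_apply_le h ξ)

@[simp] theorem creation_apply {p q r : S} (h : p * q = r) (ξ : M.fiber p) (η : M.fiber q) :
    creation h ξ η = M.mul h ξ η := rfl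

theorem norm_creation_le {p q r : S} (h : p * q = r) (ξ : M.fiber p) : ‖creation h ξ‖ ≤ ‖ξ‖ :=
  LinearMap.mkContinuous_norm_le _ (norm_nonneg _) _

theorem exists_annihilation {p q r : S} (h : p * q = r) (ξ : M.fiber p) :
    ∃ T' : M.fiber r →L[ℂ] M.fiber q, ∀ x y,
      inner Aᵐᵒᵖ (creation h ξ x) y = inner Aᵐᵒᵖ x (T' y) := by
  by_cases hp : p = 1
  · subst hp
    obtain rfl : q = r := by simpa using h
    refine ⟨(star (M.left q (M.unit ξ))).1, fun x y => ?_⟩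
    rw [creation_apply, M.unit_mul, inner_star_right]
  · refine exists_adjoint_of_dense _ _ (M.dense_mul h hp) ?_
    rintro _ ⟨x, y, rfl⟩
    exact ⟨M.left q (rinner A ξ x) y, fun z => inner_mul h ξ x z y⟩

/-- The adjoint `M_{pq} → M_q` of left multiplication by `ξ ∈ M_p`. -/
noncomputable def annihilation {p q r : S} (h : p * q = r) (ξ : M.fiber p) :
    M.fiber r →L[ℂ] M.fiber q := (exists_annihilation h ξ).choose

theorem inner_creation {p q r : S} (h : p * q = r) (ξ : M.fiber p) (x : M.fiber q)
    (y : M.fiber r) :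
    inner Aᵐᵒᵖ (M.mul h ξ x) y = inner Aᵐᵒᵖ x (annihilation h ξ y) :=
  (exists_annihilation h ξ).choose_spec x y

theorem annihilation_mul {p q r : S} (h : p * q = r) (ξ ξ' : M.fiber p) (x : M.fiber q) :
    annihilation h ξ (M.mul h ξ' x) = M.left q (rinner A ξ ξ') x :=
  ext_inner_left Aᵐᵒᵖ fun z => by rw [← inner_creation, inner_mul]

theorem norm_annihilation_le {p q r : S} (h : p * q = r) (ξ : M.fiber p) :
    ‖annihilation h ξ‖ ≤ ‖ξ‖ :=
  (norm_adjoint_le (C := Aᵐᵒᵖ) (T := creation h ξ) (inner_creation h ξ)).trans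
    (norm_creation_le h ξ)

theorem smul_inner_self_mono {E : Type*} [NormedAddCommGroup E] [NormedSpace ℂ E] [SMul Aᵐᵒᵖ E]
    [CStarModule Aᵐᵒᵖ E] {k l : ℝ} (hk : 0 ≤ k) (hkl : k ≤ l) (x : E) :
    (k ^ 2) • inner Aᵐᵒᵖ x x ≤ (l ^ 2) • inner Aᵐᵒᵖ x x :=
  smul_le_smul_of_nonneg_right (pow_le_pow_left₀ hk hkl 2) CStarModule.inner_self_nonneg

theorem inner_creation_le {p q r : S} (h : p * q = r) (ξ : M.fiber p) (x : M.fiber q) :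
    inner Aᵐᵒᵖ (M.mul h ξ x) (M.mul h ξ x) ≤ (‖ξ‖ ^ 2) • inner Aᵐᵒᵖ x x :=
  (inner_map_self_le (T := creation h ξ) (inner_creation h ξ) x).trans
    (smul_inner_self_mono (norm_nonneg _) (norm_creation_le h ξ) x)

theorem inner_annihilation_le {p q r : S} (h : p * q = r) (ξ : M.fiber p) (x : M.fiber r) :
    inner Aᵐᵒᵖ (annihilation h ξ x) (annihilation h ξ x) ≤ (‖ξ‖ ^ 2) • inner Aᵐᵒᵖ x x :=
  (inner_map_self_le (T := annihilation h ξ) (T' := creation h ξ) (fun x y => by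
    rw [← CStarModule.star_inner, creation_apply, ← inner_creation, CStarModule.star_inner]) x).trans
    (smul_inner_self_mono (norm_nonneg _) (norm_annihilation_le h ξ) x)

variable (M) in
/-- The Fock module `F(M)`, the Hilbert module direct sum of the fibres. -/
abbrev Fock : Type (max v w) := HilbertSum Aᵐᵒᵖ M.fiber

variable [IsLeftCancelMul S]

open Classical in
/-- The family `(χ_{pS}(q) ξ η_{r})_q`, where `q = pr`. -/
noncomputable def fockFun {p : S} (ξ : M.fiber p) (η : ∀ q, M.fiber q) (q : S) : M.fiber q :=
  if h : ∃ r, p * r = q then M.mul h.choose_spec ξ (η h.choose) else 0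

theorem fockFun_mul {p q r : S} (h : p * r = q) (ξ : M.fiber p) (η : ∀ q, M.fiber q) :
    fockFun ξ η q = M.mul h ξ (η r) := by
  have h' : ∃ r, p * r = q := ⟨r, h⟩
  have aux : ∀ (s : S) (hs : p * s = q), M.mul hs ξ (η s) = M.mul h ξ (η r) := by
    intro s hs
    obtain rfl : s = r := mul_left_cancel (hs.trans h.symm)
    rfl
  rw [fockFun, dif_pos h', aux]

theorem fockFun_eq_zero {p q : S} (h : ¬ ∃ r, p * r = q) (ξ : M.fiber p)
    (η : ∀ q, M.fiber q) : fockFun ξ η q = 0 := dif_neg h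

theorem summable_fockFun {p : S} (ξ : M.fiber p) (η : M.Fock) :
    Summable fun q => inner Aᵐᵒᵖ (fockFun ξ η q) (fockFun ξ η q) := by
  rw [← (mul_right_injective p).summable_iff]
  · refine summable_of_nonneg_of_le (fun _ => CStarModule.inner_self_nonneg) (fun r => ?_)
      (η.2.const_smul (‖ξ‖ ^ 2))
    simp only [Function.comp_apply]
    rw [fockFun_mul rfl]
    exact inner_creation_le rfl ξ (η r)
  · intro q hq
    rw [fockFun_eq_zero hq]
    simp

theorem summable_annihilation {p : S} (ξ : M.fiber p) (η : M.Fock) :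
    Summable fun r => inner Aᵐᵒᵖ (annihilation (rfl : p * r = p * r) ξ (η (p * r)))
      (annihilation (rfl : p * r = p * r) ξ (η (p * r))) :=
  summable_of_nonneg_of_le (fun _ => CStarModule.inner_self_nonneg)
    (fun r => inner_annihilation_le rfl ξ (η (p * r)))
    ((η.2.comp_injective (mul_right_injective p)).const_smul (‖ξ‖ ^ 2))

theorem norm_le_of_inner_le {E F : Type*} [NormedAddCommGroup E] [NormedSpace ℂ E] [SMul Aᵐᵒᵖ E]
    [CStarModule Aᵐᵒᵖ E] [NormedAddCommGroup F] [NormedSpace ℂ F] [SMul Aᵐᵒᵖ F]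
    [CStarModule Aᵐᵒᵖ F] {k : ℝ} (hk : 0 ≤ k) {x : E} {y : F}
    (h : inner Aᵐᵒᵖ x x ≤ (k ^ 2) • inner Aᵐᵒᵖ y y) : ‖x‖ ≤ k * ‖y‖ := by
  have h1 : ‖x‖ ^ 2 ≤ (k * ‖y‖) ^ 2 := by
    rw [mul_pow, CStarModule.norm_sq_eq (A := Aᵐᵒᵖ), CStarModule.norm_sq_eq (A := Aᵐᵒᵖ)]
    refine (CStarAlgebra.norm_le_norm_of_nonneg_of_le CStarModule.inner_self_nonneg h).trans ?_
    rw [norm_smul, Real.norm_of_nonneg (by positivity)]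
  exact (pow_le_pow_iff_left₀ (norm_nonneg _) (by positivity) (by simp)).mp h1

/-- The inner product of `fockFun ξ η` with a vector only involves the indices in `pS`. -/
theorem tsum_inner_fockFun {p : S} (ξ : M.fiber p) (η : ∀ q, M.fiber q) (ζ : ∀ q, M.fiber q) :
    ∑' q, inner Aᵐᵒᵖ (fockFun ξ η q) (ζ q) =
      ∑' r, inner Aᵐᵒᵖ (M.mul (rfl : p * r = p * r) ξ (η r)) (ζ (p * r)) := by
  rw [← (mul_right_injective p).tsum_eq]
  · exact tsum_congr fun r => by rw [fockFun_mul rfl]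
  · intro q hq
    by_contra h
    exact hq (by simp only [fockFun_eq_zero h]; simp)

/-- The operator `(η_q)_q ↦ (χ_{pS}(q) ξ η_r)_q`, where `q = pr`, on the Fock module. -/
noncomputable def fockCreate {p : S} (ξ : M.fiber p) : M.Fock →L[ℂ] M.Fock :=
  LinearMap.mkContinuous
    { toFun := fun η => ⟨fockFun ξ η.1, summable_fockFun ξ η⟩
      map_add' := fun η η' => HilbertSum.ext fun q => by
        by_cases h : ∃ r, p * r = q
        · obtain ⟨r, rfl⟩ := h
          change fockFun ξ _ _ = fockFun ξ _ _ + fockFun ξ _ _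
          simp only [fockFun_mul rfl, HilbertSum.add_apply, map_add]
        · change fockFun ξ _ _ = fockFun ξ _ _ + fockFun ξ _ _
          simp only [fockFun_eq_zero h, add_zero]
      map_smul' := fun k η => HilbertSum.ext fun q => by
        by_cases h : ∃ r, p * r = q
        · obtain ⟨r, rfl⟩ := h
          change fockFun ξ _ _ = k • fockFun ξ _ _
          simp only [fockFun_mul rfl, HilbertSum.smul_apply, map_smul]
        · change fockFun ξ _ _ = k • fockFun ξ _ _
          simp only [fockFun_eq_zero h, smul_zero] }
    ‖ξ‖ fun η => norm_le_of_inner_le (norm_nonneg _) <| by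
      change ∑' q, inner Aᵐᵒᵖ (fockFun ξ η.1 q) (fockFun ξ η.1 q) ≤ _
      rw [tsum_inner_fockFun, HilbertSum.inner_def, ← η.2.tsum_const_smul]
      refine Summable.tsum_le_tsum (fun r => ?_) ?_ (η.2.const_smul _)
      · rw [fockFun_mul rfl]
        exact inner_creation_le rfl ξ (η r)
      · refine ((mul_right_injective p).summable_iff (f := fun q =>
          inner Aᵐᵒᵖ (fockFun ξ η.1 q) (fockFun ξ η.1 q)) ?_).mpr
            (summable_fockFun ξ η) |>.congr fun r => ?_
        · intro q hq
          rw [fockFun_eq_zero hq]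
          simp
        · simp only [Function.comp_apply, fockFun_mul rfl]

/-- The adjoint of `fockCreate ξ`. -/
noncomputable def fockAnnihilate {p : S} (ξ : M.fiber p) : M.Fock →L[ℂ] M.Fock :=
  LinearMap.mkContinuous
    { toFun := fun η => ⟨fun r => annihilation (rfl : p * r = p * r) ξ (η (p * r)),
        summable_annihilation ξ η⟩
      map_add' := fun η η' => HilbertSum.ext fun r => map_add _ _ _
      map_smul' := fun k η => HilbertSum.ext fun r => map_smul _ _ _ }
    ‖ξ‖ fun η => norm_le_of_inner_le (norm_nonneg _) <| by
      have h1 : Summable fun r => inner Aᵐᵒᵖ (η (p * r)) (η (p * r)) :=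
        η.2.comp_injective (mul_right_injective p)
      calc ∑' r, inner Aᵐᵒᵖ (annihilation (rfl : p * r = p * r) ξ (η (p * r)))
              (annihilation (rfl : p * r = p * r) ξ (η (p * r)))
          ≤ ∑' r, (‖ξ‖ ^ 2) • inner Aᵐᵒᵖ (η (p * r)) (η (p * r)) :=
            Summable.tsum_le_tsum (fun r => inner_annihilation_le rfl ξ (η (p * r)))
              (summable_annihilation ξ η) (h1.const_smul _)
        _ = (‖ξ‖ ^ 2) • ∑' r, inner Aᵐᵒᵖ (η (p * r)) (η (p * r)) := h1.tsum_const_smul _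
        _ ≤ (‖ξ‖ ^ 2) • inner Aᵐᵒᵖ η η := by
            refine smul_le_smul_of_nonneg_left ?_ (by positivity)
            exact Summable.tsum_le_tsum_of_inj (fun r => p * r) (mul_right_injective p)
              (fun _ _ => CStarModule.inner_self_nonneg) (fun _ => le_rfl) h1 η.2

theorem inner_fockCreate {p : S} (ξ : M.fiber p) (η ζ : M.Fock) :
    inner Aᵐᵒᵖ (fockCreate ξ η) ζ = inner Aᵐᵒᵖ η (fockAnnihilate ξ ζ) := by
  change ∑' q, inner Aᵐᵒᵖ (fockFun ξ η.1 q) (ζ.1 q) = _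
  rw [tsum_inner_fockFun]
  exact tsum_congr fun r => inner_creation rfl ξ (η r) (ζ (p * r))

/-- `ψ_{F,p}(ξ) ∈ 𝓛(F(M))`. -/
noncomputable def fockOp {p : S} (ξ : M.fiber p) : Adjointable Aᵐᵒᵖ M.Fock :=
  ⟨fockCreate ξ, fockAnnihilate ξ, inner_fockCreate ξ⟩

theorem fockOp_apply_mul {p q r : S} (h : p * r = q) (ξ : M.fiber p) (η : M.Fock) :
    (fockOp ξ η) q = M.mul h ξ (η r) := fockFun_mul h ξ η.1

theorem fockOp_apply_eq_zero {p q : S} (h : ¬ ∃ r, p * r = q) (ξ : M.fiber p) (η : M.Fock) :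
    (fockOp ξ η) q = 0 := fockFun_eq_zero h ξ η.1

theorem star_fockOp_apply {p : S} (ξ : M.fiber p) (η : M.Fock) (r : S) :
    (star (fockOp ξ) η) r = annihilation (rfl : p * r = p * r) ξ (η (p * r)) := by
  have h : star (fockOp ξ) = ⟨fockAnnihilate ξ, fockCreate ξ, fun x y => by
      rw [← CStarModule.star_inner, ← inner_fockCreate, CStarModule.star_inner]⟩ :=
    star_eq_of (inner_fockCreate ξ)
  rw [h]; rfl

theorem fockOp_unit_apply (a : A) (η : M.Fock) (q : S) :
    (fockOp (M.unit.symm a) η) q = M.left q a (η q) := by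
  rw [fockOp_apply_mul (one_mul q), M.unit_mul, LinearEquiv.apply_symm_apply]

variable (M) in
/-- The Fock representation `ψ_F : M → 𝓛(F(M))`, given by
`ψ_{F,p}(ξ) (η_q)_q = (χ_{pS}(q) ξ η_r)_q`, where `q = pr`. -/
noncomputable def fockRep : M.Representation (Adjointable Aᵐᵒᵖ M.Fock) where
  toFun p :=
    { toFun := fun ξ => fockOp ξ
      map_add' := fun ξ ξ' => adjointable_ext fun η => HilbertSum.ext fun q => by
        change _ = (fockOp ξ η) q + (fockOp ξ' η) q
        by_cases h : ∃ r, p * r = q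
        · obtain ⟨r, rfl⟩ := h
          simp only [fockOp_apply_mul rfl, map_add, LinearMap.add_apply]
        · simp only [fockOp_apply_eq_zero h, add_zero]
      map_smul' := fun k ξ => adjointable_ext fun η => HilbertSum.ext fun q => by
        change _ = k • (fockOp ξ η) q
        by_cases h : ∃ r, p * r = q
        · obtain ⟨r, rfl⟩ := h
          simp only [fockOp_apply_mul rfl, map_smul, LinearMap.smul_apply]
        · simp only [fockOp_apply_eq_zero h, smul_zero] }
  map_mul {p q r} h ξ η := adjointable_ext fun ζ => HilbertSum.ext fun t => by
    change (fockOp ξ (fockOp η ζ)) t = (fockOp (M.mul h ξ η) ζ) t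
    by_cases ht : ∃ s, r * s = t
    · obtain ⟨s, hs⟩ := ht
      have h' : p * (q * s) = t := by rw [← mul_assoc, h, hs]
      rw [fockOp_apply_mul h', fockOp_apply_mul rfl, fockOp_apply_mul hs]
      exact (M.assoc h hs rfl h' ξ η (ζ s)).symm
    · rw [fockOp_apply_eq_zero ht]
      by_cases h1 : ∃ s, p * s = t
      · obtain ⟨s, hs⟩ := h1
        rw [fockOp_apply_mul hs, fockOp_apply_eq_zero, map_zero]
        rintro ⟨x, rfl⟩
        exact ht ⟨x, by rw [← h, mul_assoc, hs]⟩
      · rw [fockOp_apply_eq_zero h1]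
  map_star a := (star_eq_of fun x y => tsum_congr fun q => by
    change inner Aᵐᵒᵖ ((fockOp (M.unit.symm a) x) q) (y q) =
      inner Aᵐᵒᵖ (x q) ((fockOp (M.unit.symm (star a)) y) q)
    rw [fockOp_unit_apply, fockOp_unit_apply, map_star, inner_star_right]).symm
  map_rinner p ξ η := adjointable_ext fun ζ => HilbertSum.ext fun q => by
    change (star (fockOp ξ) (fockOp η ζ)) q = (fockOp (M.unit.symm (rinner A ξ η)) ζ) q
    rw [star_fockOp_apply, fockOp_apply_mul rfl, annihilation_mul, fockOp_unit_apply]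

end ProductSystem

/-! The first point is that `ψ^{(p)}` exists for every representation `ψ`. An element `b` of the
span of the `ψ_p(ξ)ψ_p(η)*` that corresponds to a finite rank operator `T` satisfies `b ψ_p(ζ) =
ψ_p(Tζ)`. Hence `bⁿ` times a fixed element of that span grows at most like `‖T‖ⁿ`, and for
self-adjoint `b` this forces `‖b‖ ≤ ‖T‖`. Passing to `b*b` gives the bound in general
(`norm_snd_le_of_mem_finiteRankGraph`), so `Θ_{ξ,η} ↦ ψ_p(ξ)ψ_p(η)*` extends to a contraction on
`𝓚(M_p)` (`exists_onCompacts`).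

For the Fock representation, `ψ_F^{(p)}(T)` is a diagonal operator on `F(M)`: it vanishes on `M_t`
for `t ∉ pS` and acts as `ι_p^t(T)` for `t ∈ pS` (`fockRep_onCompacts_apply`). The diagonal entries
also show that `T ⊗ id` exists. A product `ψ_F^{(p)}(T) ψ_F^{(q)}(T')` therefore lives on the fibres
over `pS ∩ qS`. If this set is empty, the product is zero. If it is `rS`, covariance is the
fibrewise identity `ι_r^t(ι_p^r(T) ι_q^r(T')) = ι_p^t(T) ι_q^t(T')` (`iota_iota_mul_iota`). Both
sides agree on `M_r M_x` with `rx = t`, and the only delicate case is `r = 1`, where such products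
need not be dense. If `p` or `q` differs from `1`, then `S` has a nontrivial unit and density holds
after all (`dense_one_mul_of_unit`); if `p = q = 1`, both sides are left actions of the same element
of `A`.

The universal algebra is generated inside an `ℓ^∞`-product of Nica covariant representations, one
for each norm function on `*`-polynomials that such a representation induces. It is nonzero because
`ψ_F` factors through it and is injective on `A`: already on the summand `M_1 = A` of `F(M)`, `A`
acts faithfully by left multiplication. -/

namespace HilbertMod

/-! ### Rank one operators, and reduction of statements about compact operators to them -/

section RankOne

variable {C : Type*} [NonUnitalCStarAlgebra C] [PartialOrder C] [StarOrderedRing C]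
variable {E : Type*} [NormedAddCommGroup E] [NormedSpace ℂ E] [SMul C E] [CStarModule C E]

theorem adjointable_mul_apply (S T : Adjointable C E) (x : E) : (S * T) x = S (T x) := rfl

theorem adjointable_map_act (T : Adjointable C E) (c : C) (x : E) : T (c • x) = c • T x :=
  ext_inner_left C fun z => by
    rw [← inner_star_left, CStarModule.inner_op_smul_right, CStarModule.inner_op_smul_right,
      inner_star_left]

theorem mul_rankOne (T : Adjointable C E) (ξ η : E) : T * rankOne ξ η = rankOne (T ξ) η :=
  adjointable_ext fun x => by
    rw [adjointable_mul_apply, rankOne_apply, rankOne_apply, adjointable_map_act]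

theorem star_rankOne (ξ η : E) : star (rankOne ξ η : Adjointable C E) = rankOne η ξ :=
  star_eq_of fun x y => by simp

/-- A closed linear condition on compact operators may be checked on rank one operators. -/
theorem compacts_induction {P : Submodule ℂ (Adjointable C E)}
    (hP : IsClosed (P : Set (Adjointable C E))) (h : ∀ ξ η : E, rankOne ξ η ∈ P) :
    compacts C E ≤ P :=
  Submodule.topologicalClosure_minimal _ (Submodule.span_le.mpr (by
    rintro _ ⟨ξ, η, rfl⟩
    exact h ξ η)) hP

/-- A closed linear condition on elements of `𝓚(E)` may be checked on rank one operators. -/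
theorem compacts_subtype_induction {Q : Submodule ℂ (compacts C E)}
    (hQ : IsClosed (Q : Set (compacts C E)))
    (h : ∀ ξ η : E, ⟨rankOne ξ η, rankOne_mem_compacts ξ η⟩ ∈ Q) (T : compacts C E) : T ∈ Q := by
  have hc : IsClosed (compacts C E : Set (Adjointable C E)) :=
    Submodule.isClosed_topologicalClosure _
  have h1 : compacts C E ≤ Q.map (compacts C E).subtype := by
    refine compacts_induction ?_ fun ξ η => ⟨_, h ξ η, rfl⟩
    rw [Submodule.map_coe]
    exact hc.isClosedEmbedding_subtypeVal.isClosedMap _ hQ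
  obtain ⟨T', hT', hTT'⟩ := h1 T.2
  rwa [← Subtype.ext hTT']

/-- Two continuous linear maps on the compact operators agreeing on rank one operators are equal. -/
theorem compacts_hom_ext {B : Type*} [AddCommGroup B] [Module ℂ B] [TopologicalSpace B] [T2Space B]
    {f g : compacts C E →L[ℂ] B}
    (h : ∀ ξ η : E, f ⟨rankOne ξ η, rankOne_mem_compacts ξ η⟩ =
      g ⟨rankOne ξ η, rankOne_mem_compacts ξ η⟩) : f = g :=
  ContinuousLinearMap.ext fun T => compacts_subtype_induction
    (Q := LinearMap.eqLocus f.toLinearMap g.toLinearMap) (isClosed_eq f.continuous g.continuous) h T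

end RankOne

end HilbertMod

/-! ### A spectral radius estimate -/

/-- A self-adjoint element whose powers grow no faster than those of `k` has norm at most `k`. -/
theorem IsSelfAdjoint.norm_le_of_norm_pow_le {B : Type*} [NonUnitalCStarAlgebra B] {b : B}
    (hb : IsSelfAdjoint b) {c k : ℝ} (hk : 0 ≤ k)
    (h : ∀ n : ℕ, ‖(fun x => b * x)^[n] b‖ ≤ c * k ^ n) : ‖b‖ ≤ k := by
  -- The iteration starts at `b` rather than at a unit, so the `n`-th iterate is the power `n + 1`.
  have hU : ∀ n : ℕ, (((fun x => b * x)^[n] b : B) : Unitization ℂ B) =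
      (b : Unitization ℂ B) ^ (n + 1) := by
    intro n
    induction n with
    | zero => simp
    | succ n ih => rw [Function.iterate_succ_apply', Unitization.inr_mul, ih, pow_succ' _ (n + 1)]
  have hbU : IsSelfAdjoint (b : Unitization ℂ B) := by
    rw [IsSelfAdjoint, ← Unitization.inr_star, hb.star_eq]
  by_contra! hlt
  have hb0 : 0 < ‖b‖ := hk.trans_lt hlt
  -- For self-adjoint `b` the C*-identity gives `‖b^(2^n)‖ = ‖b‖^(2^n)` exactly. If `k < ‖b‖`,
  -- dividing by `‖b‖^(2^n - 1)` bounds `‖b‖` by a sequence tending to `0`.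
  have h1 : ∀ n : ℕ, ‖b‖ * (‖b‖ ^ (2 ^ n - 1)) ≤ c * k ^ (2 ^ n - 1) := by
    intro n
    refine le_trans (le_of_eq ?_) (h (2 ^ n - 1))
    rw [← Unitization.norm_inr (𝕜 := ℂ) (a := (fun x => b * x)^[2 ^ n - 1] b), hU,
      Nat.sub_add_cancel Nat.one_le_two_pow, ← pow_succ', Nat.sub_add_cancel Nat.one_le_two_pow]
    have := hbU.nnnorm_pow_two_pow n
    rw [← coe_nnnorm (_ ^ _), this]
    simp [Unitization.norm_inr]
  have h2 : Filter.Tendsto (fun n : ℕ => c * (k / ‖b‖) ^ (2 ^ n - 1)) Filter.atTop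
      (nhds (c * 0)) := by
    refine Filter.Tendsto.const_mul _ ((tendsto_pow_atTop_nhds_zero_of_lt_one (by positivity)
      ((div_lt_one hb0).mpr hlt)).comp ?_)
    refine Filter.tendsto_atTop_mono (fun n => ?_) Filter.tendsto_id
    exact Nat.le_sub_one_of_lt Nat.lt_two_pow_self
  rw [mul_zero] at h2
  refine absurd (ge_of_tendsto' (b := ‖b‖) h2 fun n => ?_) (not_le.mpr hb0)
  rw [div_pow, ← mul_div_assoc, le_div_iff₀ (by positivity)]
  exact h1 n

/-! ### Existence of `ψ^{(p)}` on the compact operators -/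

namespace ProductSystem

variable {A : Type u} [NonUnitalCStarAlgebra A] [PartialOrder A] [StarOrderedRing A]
  {S : Type v} [Monoid S] {M : ProductSystem.{u, v, w} A S}

namespace Representation

variable {B : Type*} [NonUnitalCStarAlgebra B] (ψ : M.Representation B)

/-- The `*`-homomorphism `ψ_1 : A → B`. -/
def unitHom : A →⋆ₙₐ[ℂ] B where
  toFun a := ψ.toFun 1 (M.unit.symm a)
  map_smul' k a := by simp
  map_zero' := by simp
  map_add' a b := by simp
  map_mul' a b := by
    rw [ψ.map_mul (mul_one 1), M.unit_mul]
    congr 1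
    apply M.unit.injective
    rw [M.unit_left]
    simp
  map_star' := ψ.map_star

theorem star_mul_toFun {p : S} (ξ η : M.fiber p) :
    star (ψ.toFun p ξ) * ψ.toFun p η = ψ.unitHom (rinner A ξ η) := ψ.map_rinner p ξ η

theorem norm_toFun_le {p : S} (ξ : M.fiber p) : ‖ψ.toFun p ξ‖ ≤ ‖ξ‖ := by
  refine (pow_le_pow_iff_left₀ (norm_nonneg _) (norm_nonneg _) two_ne_zero).mp ?_
  rw [pow_two, ← CStarRing.norm_star_mul_self, star_mul_toFun, ← norm_rinner_self (A := A)]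
  exact NonUnitalStarAlgHom.norm_apply_le _ _

theorem toFun_mul_unitHom {p : S} (ξ : M.fiber p) (a : A) :
    ψ.toFun p ξ * ψ.unitHom a = ψ.toFun p (MulOpposite.op a • ξ) := by
  refine (ψ.map_mul (mul_one p) _ _).trans ?_
  rw [M.mul_unit, LinearEquiv.apply_symm_apply]

theorem toFun_mul_star_mul {p : S} (ξ η ζ : M.fiber p) :
    ψ.toFun p ξ * star (ψ.toFun p η) * ψ.toFun p ζ =
      ψ.toFun p ((rankOne ξ η : Adjointable Aᵐᵒᵖ (M.fiber p)) ζ) := by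
  rw [mul_assoc, star_mul_toFun, toFun_mul_unitHom]
  rfl

/-- The graph of `Θ_{ξ,η} ↦ ψ_p(ξ) ψ_p(η)*` on the finite rank operators. -/
noncomputable def finiteRankGraph (p : S) : Submodule ℂ (Adjointable Aᵐᵒᵖ (M.fiber p) × B) :=
  Submodule.span ℂ (Set.range fun x : M.fiber p × M.fiber p =>
    (rankOne x.1 x.2, ψ.toFun p x.1 * star (ψ.toFun p x.2)))

variable {ψ} {p : S}

/-- This is how the operator coordinate controls the algebra coordinate, before it is known that the
relation is the graph of a map. -/
theorem finiteRankGraph_mul_toFun {x : Adjointable Aᵐᵒᵖ (M.fiber p) × B}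
    (hx : x ∈ ψ.finiteRankGraph p) (ζ : M.fiber p) :
    x.2 * ψ.toFun p ζ = ψ.toFun p (x.1 ζ) := by
  induction hx using Submodule.span_induction with
  | mem x hx =>
    obtain ⟨⟨ξ, η⟩, rfl⟩ := hx
    exact ψ.toFun_mul_star_mul ξ η ζ
  | zero =>
    change 0 * _ = ψ.toFun p 0
    rw [zero_mul, map_zero]
  | add x y hx hy ihx ihy =>
    change (x.2 + y.2) * _ = ψ.toFun p (x.1 ζ + y.1 ζ)
    rw [add_mul, map_add, ihx, ihy]
  | smul k x hx ih =>
    change (k • x.2) * _ = ψ.toFun p (k • x.1 ζ)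
    rw [smul_mul_assoc, map_smul, ih]

theorem finiteRankGraph_star {x : Adjointable Aᵐᵒᵖ (M.fiber p) × B}
    (hx : x ∈ ψ.finiteRankGraph p) : star x ∈ ψ.finiteRankGraph p := by
  induction hx using Submodule.span_induction with
  | mem x hx =>
    obtain ⟨⟨ξ, η⟩, rfl⟩ := hx
    exact Submodule.subset_span ⟨(η, ξ), by simp [Prod.ext_iff, star_rankOne]⟩
  | zero => rw [star_zero]; exact zero_mem _
  | add x y hx hy ihx ihy => rw [star_add]; exact add_mem ihx ihy
  | smul k x hx ih => rw [star_smul]; exact Submodule.smul_mem _ _ ih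

/-- Left multiplication by `x` sends the generator given by `(ξ, η)` to the one given by `(x.1 ξ,
η)`. -/
theorem finiteRankGraph_mul {x y : Adjointable Aᵐᵒᵖ (M.fiber p) × B}
    (hx : x ∈ ψ.finiteRankGraph p) (hy : y ∈ ψ.finiteRankGraph p) :
    x * y ∈ ψ.finiteRankGraph p := by
  induction hy using Submodule.span_induction with
  | mem y hy =>
    obtain ⟨⟨ξ, η⟩, rfl⟩ := hy
    refine Submodule.subset_span ⟨(x.1 ξ, η), Prod.ext ?_ ?_⟩
    · exact (mul_rankOne x.1 ξ η).symm
    · change _ = x.2 * (ψ.toFun p ξ * star (ψ.toFun p η))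
      rw [← mul_assoc, finiteRankGraph_mul_toFun hx]
  | zero => rw [mul_zero]; exact zero_mem _
  | add y z _ _ ihy ihz => rw [mul_add]; exact add_mem ihy ihz
  | smul k y _ ih => rw [mul_smul_comm]; exact Submodule.smul_mem _ _ ih

/-- The constant depends on `y` only: for a generator it is `‖ξ‖ * ‖η‖`, since multiplying by `x`
replaces `ξ` by `x.1 ξ`, and it passes to linear combinations by the triangle inequality. Iterates
replace powers because `B` need not have a unit. -/
theorem exists_norm_iterate_le {y : Adjointable Aᵐᵒᵖ (M.fiber p) × B}
    (hy : y ∈ ψ.finiteRankGraph p) :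
    ∃ c : ℝ, ∀ x ∈ ψ.finiteRankGraph p, ∀ n : ℕ,
      ‖(fun b => x.2 * b)^[n] y.2‖ ≤ c * ‖x.1‖ ^ n := by
  induction hy using Submodule.span_induction with
  | mem y hy =>
    obtain ⟨⟨ξ, η⟩, rfl⟩ := hy
    refine ⟨‖ξ‖ * ‖η‖, fun x hx n => ?_⟩
    have key : ∃ ξ' : M.fiber p, ‖ξ'‖ ≤ ‖x.1‖ ^ n * ‖ξ‖ ∧
        (fun b => x.2 * b)^[n] (ψ.toFun p ξ * star (ψ.toFun p η)) =
          ψ.toFun p ξ' * star (ψ.toFun p η) := by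
      induction n with
      | zero => exact ⟨ξ, by simp, rfl⟩
      | succ n ih =>
        obtain ⟨ξ', h1, h2⟩ := ih
        refine ⟨x.1 ξ', ?_, ?_⟩
        · calc ‖x.1 ξ'‖ ≤ ‖x.1‖ * ‖ξ'‖ := x.1.1.le_opNorm ξ'
            _ ≤ ‖x.1‖ * (‖x.1‖ ^ n * ‖ξ‖) := by gcongr
            _ = _ := by ring
        · rw [Function.iterate_succ_apply', h2, ← mul_assoc, finiteRankGraph_mul_toFun hx]
    obtain ⟨ξ', h1, h2⟩ := key
    rw [h2]
    calc ‖ψ.toFun p ξ' * star (ψ.toFun p η)‖ ≤ ‖ψ.toFun p ξ'‖ * ‖star (ψ.toFun p η)‖ :=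
          norm_mul_le _ _
      _ ≤ ‖ξ'‖ * ‖η‖ := by
          rw [norm_star]; gcongr <;> exact ψ.norm_toFun_le _
      _ ≤ (‖x.1‖ ^ n * ‖ξ‖) * ‖η‖ := by gcongr
      _ = _ := by ring
  | zero =>
    refine ⟨0, fun x _ n => ?_⟩
    have : (fun b => x.2 * b)^[n] (0 : B) = 0 := Function.iterate_fixed (mul_zero _) n
    simp [this]
  | add y z _ _ ihy ihz =>
    obtain ⟨c, hc⟩ := ihy
    obtain ⟨d, hd⟩ := ihz
    refine ⟨c + d, fun x hx n => ?_⟩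
    have h := iterate_map_add (AddMonoidHom.mulLeft x.2) n y.2 z.2
    rw [add_mul]
    exact (congrArg norm h).trans_le ((norm_add_le _ _).trans (add_le_add (hc x hx n) (hd x hx n)))
  | smul k y _ ih =>
    obtain ⟨c, hc⟩ := ih
    refine ⟨‖k‖ * c, fun x hx n => ?_⟩
    have h : (fun b => x.2 * b)^[n] (k • y.2) = k • (fun b => x.2 * b)^[n] y.2 := by
      induction n with
      | zero => rfl
      | succ n ih => rw [Function.iterate_succ_apply', ih, mul_smul_comm,
          Function.iterate_succ_apply']
    rw [Prod.smul_snd, h, norm_smul, mul_assoc]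
    exact mul_le_mul_of_nonneg_left (hc x hx n) (norm_nonneg _)

/-- The growth estimate is applied to `star x * x`, both as the multiplier and as the starting
element. Its algebra coordinate is self-adjoint, and the C*-identity in both coordinates then
removes the squares. -/
theorem norm_snd_le_of_mem_finiteRankGraph {x : Adjointable Aᵐᵒᵖ (M.fiber p) × B}
    (hx : x ∈ ψ.finiteRankGraph p) : ‖x.2‖ ≤ ‖x.1‖ := by
  have hy := finiteRankGraph_mul (finiteRankGraph_star hx) hx
  obtain ⟨c, hc⟩ := exists_norm_iterate_le hy
  have h := (IsSelfAdjoint.star_mul_self x.2).norm_le_of_norm_pow_le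
    (norm_nonneg (star x * x).1) fun n => hc _ hy n
  refine (pow_le_pow_iff_left₀ (norm_nonneg _) (norm_nonneg _) two_ne_zero).mp ?_
  rw [pow_two, pow_two, ← CStarRing.norm_star_mul_self, ← CStarRing.norm_star_mul_self]
  exact h

variable (ψ p) in
theorem exists_onCompacts : ∃ Ψ : compacts Aᵐᵒᵖ (M.fiber p) →L[ℂ] B, ∀ ξ η : M.fiber p,
    Ψ ⟨rankOne ξ η, rankOne_mem_compacts ξ η⟩ = ψ.toFun p ξ * star (ψ.toFun p η) := by
  have bd : ∀ x ∈ (ψ.finiteRankGraph p).topologicalClosure, ‖x.2‖ ≤ ‖x.1‖ := by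
    intro x hx
    exact closure_minimal (fun y hy => norm_snd_le_of_mem_finiteRankGraph hy)
      (isClosed_le continuous_snd.norm continuous_fst.norm) hx
  let G := (ψ.finiteRankGraph p).topologicalClosure
  have hG : IsClosed (G : Set (Adjointable Aᵐᵒᵖ (M.fiber p) × B)) :=
    Submodule.isClosed_topologicalClosure _
  have : CompleteSpace G := hG.completeSpace_coe
  let f : G →ₗ[ℂ] Adjointable Aᵐᵒᵖ (M.fiber p) := LinearMap.fst ℂ _ _ ∘ₗ G.subtype
  -- By `bd` the maximum norm of a pair in `G` is the norm of its first coordinate. Completeness of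
  -- `G` then makes the range of `f` closed, so it contains all compact operators once it contains
  -- the rank one operators.
  have hf : Isometry f := AddMonoidHomClass.isometry_of_norm f fun x => by
    change ‖x.1.1‖ = max ‖x.1.1‖ ‖x.1.2‖
    rw [max_eq_left (bd x.1 x.2)]
  have hall : compacts Aᵐᵒᵖ (M.fiber p) ≤ LinearMap.range f := by
    refine compacts_induction ?_ fun ξ η => ?_
    · rw [LinearMap.coe_range]
      exact hf.isClosedEmbedding.isClosed_range
    · exact ⟨⟨_, Submodule.le_topologicalClosure _ (Submodule.subset_span ⟨(ξ, η), rfl⟩)⟩, rfl⟩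
  have hex : ∀ T : compacts Aᵐᵒᵖ (M.fiber p), ∃ b : B, (T.1, b) ∈ G := by
    intro T
    obtain ⟨⟨⟨_, b⟩, hx⟩, h⟩ := hall T.2
    exact ⟨b, by rw [← h]; exact hx⟩
  have huniq : ∀ {T b b'}, (T, b) ∈ G → (T, b') ∈ G → b = b' := by
    intro T b b' h h'
    have h1 := bd _ (G.sub_mem h h')
    simp only [Prod.mk_sub_mk, sub_self, norm_zero] at h1
    exact sub_eq_zero.mp (norm_le_zero_iff.mp h1)
  choose g hg using hex
  refine ⟨LinearMap.mkContinuous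
    { toFun := g
      map_add' := fun x y => huniq (hg _) (G.add_mem (hg x) (hg y))
      map_smul' := fun k x => huniq (hg _) (G.smul_mem k (hg x)) } 1 fun x => ?_, fun ξ η => ?_⟩
  · rw [one_mul]
    exact bd _ (hg x)
  · exact huniq (hg _) (Submodule.le_topologicalClosure _ (Submodule.subset_span ⟨(ξ, η), rfl⟩))

variable (ψ) in
theorem onCompacts_rankOne (ξ η : M.fiber p) :
    ψ.onCompacts p ⟨rankOne ξ η, rankOne_mem_compacts ξ η⟩ =
      ψ.toFun p ξ * star (ψ.toFun p η) := by
  have h := ψ.exists_onCompacts p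
  rw [onCompacts, dif_pos h]
  exact h.choose_spec ξ η

end Representation

end ProductSystem

/-! ### Diagonal operators on Hilbert direct sums -/

namespace HilbertMod

namespace HilbertSum

variable {C : Type*} [NonUnitalCStarAlgebra C] [PartialOrder C] [StarOrderedRing C]
variable {ι : Type*} {E : ι → Type*} [∀ i, NormedAddCommGroup (E i)] [∀ i, NormedSpace ℂ (E i)]
  [∀ i, SMul C (E i)] [∀ i, CStarModule C (E i)]

open Classical in
/-- The element of the Hilbert sum supported at a single index. -/
noncomputable def single (i : ι) (x : E i) : HilbertSum C E := trunc {i} (Function.update 0 i x)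

theorem single_apply_self (i : ι) (x : E i) : (single i x : HilbertSum C E) i = x := by
  simp [single, trunc]

theorem single_apply_of_ne {i j : ι} (h : j ≠ i) (x : E i) :
    (single i x : HilbertSum C E) j = 0 := by
  simp [single, trunc, h]

theorem inner_single_left (i : ι) (x : E i) (y : HilbertSum C E) :
    inner C (single i x) y = inner C x (y i) := by
  rw [inner_def, tsum_eq_single i fun j hj => by rw [single_apply_of_ne hj]; simp,
    single_apply_self]

theorem norm_single (i : ι) (x : E i) : ‖(single i x : HilbertSum C E)‖ = ‖x‖ := by
  refine (pow_left_inj₀ (norm_nonneg _) (norm_nonneg _) two_ne_zero).mp ?_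
  rw [CStarModule.norm_sq_eq (A := C), CStarModule.norm_sq_eq (A := C), inner_single_left,
    single_apply_self]

/-- `single`, as a continuous linear map. -/
noncomputable def singleL (i : ι) : E i →L[ℂ] HilbertSum C E :=
  LinearMap.mkContinuous
    { toFun := fun x => single i x
      map_add' := fun x y => ext fun j => by
        rcases eq_or_ne j i with rfl | h
        · simp only [add_apply, single_apply_self]
        · simp only [add_apply, single_apply_of_ne h, add_zero]
      map_smul' := fun k x => ext fun j => by
        rcases eq_or_ne j i with rfl | h
        · simp only [smul_apply, single_apply_self, RingHom.id_apply]
        · simp only [smul_apply, single_apply_of_ne h, smul_zero] } 1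
    fun x => by rw [one_mul]; exact (norm_single i x).le

/-- Evaluation at an index, as a continuous linear map. -/
noncomputable def evalL (i : ι) : HilbertSum C E →L[ℂ] E i :=
  LinearMap.mkContinuous
    { toFun := fun x => x i
      map_add' := fun _ _ => rfl
      map_smul' := fun _ _ => rfl } 1
    fun x => by rw [one_mul]; exact norm_apply_le x i

/-- The diagonal entry at `i` of an operator on the Hilbert sum. -/
noncomputable def diagEntry (i : ι) (X : Adjointable C (HilbertSum C E)) : Adjointable C (E i) :=
  ⟨evalL i ∘L X.1 ∘L singleL i, evalL i ∘L (star X).1 ∘L singleL i, fun x y => by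
    change inner C ((X (single i x)) i) y = inner C x ((star X (single i y)) i)
    rw [← inner_single_left, inner_star_right, ← CStarModule.star_inner, ← inner_single_left,
      CStarModule.star_inner]⟩

theorem diagEntry_apply (i : ι) (X : Adjointable C (HilbertSum C E)) (x : E i) :
    diagEntry i X x = (X (single i x)) i := rfl

theorem continuous_apply_apply (x : HilbertSum C E) (i : ι) :
    Continuous fun X : Adjointable C (HilbertSum C E) => (X x) i :=
  (evalL i).continuous.comp
    ((ContinuousLinearMap.apply ℂ _ x).continuous.comp continuous_subtype_val)

/-- The operators on the Hilbert sum which are diagonal and vanish at the indices outside `s`. -/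
def diagonalOn (s : Set ι) : Submodule ℂ (Adjointable C (HilbertSum C E)) where
  carrier := {X | ∀ (x : HilbertSum C E) (i : ι), (i ∈ s → x i = 0) → (X x) i = 0}
  add_mem' {X Y} hX hY x i h := by
    change (X x) i + (Y x) i = 0
    rw [hX x i h, hY x i h, add_zero]
  zero_mem' _ _ _ := rfl
  smul_mem' k X hX x i h := by
    change k • (X x) i = 0
    rw [hX x i h, smul_zero]

theorem isClosed_diagonalOn (s : Set ι) :
    IsClosed ((diagonalOn s : Submodule ℂ (Adjointable C (HilbertSum C E))) :
      Set (Adjointable C (HilbertSum C E))) := by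
  change IsClosed {X : Adjointable C (HilbertSum C E) |
    ∀ (x : HilbertSum C E) (i : ι), (i ∈ s → x i = 0) → (X x) i = 0}
  simp only [Set.ofPred_forall]
  exact isClosed_iInter fun x => isClosed_iInter fun i => isClosed_iInter fun _ =>
    isClosed_eq (continuous_apply_apply x i) continuous_const

/-- Subtracting from `x` its `i`-th component leaves a vector whose `i`-th coordinate is zero, and
diagonality applies to it. -/
theorem apply_eq_diagEntry {s : Set ι} {X : Adjointable C (HilbertSum C E)}
    (hX : X ∈ diagonalOn s) (x : HilbertSum C E) (i : ι) : (X x) i = diagEntry i X (x i) := by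
  have h := hX (x - single i (x i)) i fun _ => by rw [sub_apply, single_apply_self, sub_self]
  have h1 : X (x - single i (x i)) = X x - X (single i (x i)) := map_sub X.1 _ _
  rw [h1, sub_apply, sub_eq_zero] at h
  exact h

end HilbertSum

end HilbertMod

/-! ### `ψ^{(p)}` as a multiplier of `ψ_p(M_p)`, and compact operators on `M_1` -/

namespace ProductSystem

variable {A : Type u} [NonUnitalCStarAlgebra A] [PartialOrder A] [StarOrderedRing A]
  {S : Type v} [Monoid S] {M : ProductSystem.{u, v, w} A S}

namespace Representation

variable {B : Type*} [NonUnitalCStarAlgebra B] (ψ : M.Representation B) {p : S}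

theorem onCompacts_mem {P : Submodule ℂ B} (hP : IsClosed (P : Set B))
    (h : ∀ ξ η : M.fiber p, ψ.toFun p ξ * star (ψ.toFun p η) ∈ P)
    (T : compacts Aᵐᵒᵖ (M.fiber p)) : ψ.onCompacts p T ∈ P :=
  compacts_subtype_induction (Q := P.comap (ψ.onCompacts p).toLinearMap)
    (hP.preimage (ψ.onCompacts p).continuous)
    (fun ξ η => by
      change ψ.onCompacts p _ ∈ P
      rw [onCompacts_rankOne]
      exact h ξ η) T

/-- `ψ_p`, as a continuous linear map. -/
noncomputable def toFunL (p : S) : M.fiber p →L[ℂ] B :=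
  (ψ.toFun p).mkContinuous 1 fun ξ => by rw [one_mul]; exact ψ.norm_toFun_le ξ

theorem onCompacts_mul_toFun (T : compacts Aᵐᵒᵖ (M.fiber p)) (ζ : M.fiber p) :
    ψ.onCompacts p T * ψ.toFun p ζ = ψ.toFun p (T.1 ζ) := by
  let f : compacts Aᵐᵒᵖ (M.fiber p) →L[ℂ] B :=
    (ContinuousLinearMap.mul ℂ B).flip (ψ.toFun p ζ) ∘L ψ.onCompacts p
  let g : compacts Aᵐᵒᵖ (M.fiber p) →L[ℂ] B :=
    ψ.toFunL p ∘L ContinuousLinearMap.apply ℂ _ ζ ∘L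
      (adjointable Aᵐᵒᵖ (M.fiber p)).toSubmodule.subtypeL ∘L
        (compacts Aᵐᵒᵖ (M.fiber p)).subtypeL
  have h : f = g := compacts_hom_ext fun ξ η => by
    change ψ.onCompacts p ⟨rankOne ξ η, rankOne_mem_compacts ξ η⟩ * ψ.toFun p ζ =
      ψ.toFun p ((rankOne ξ η : Adjointable Aᵐᵒᵖ (M.fiber p)) ζ)
    rw [onCompacts_rankOne, toFun_mul_star_mul]
  exact congrArg (fun f => f T) h

/-- The difference `y` of the two sides annihilates `ψ_1(M_1)` from the left, and `y` lies in the
closed subspace of those `z` with `y * star z = 0`. Hence `y * star y = 0`. -/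
theorem onCompacts_left {T : compacts Aᵐᵒᵖ (M.fiber 1)} {a : A} (hT : T.1 = M.left 1 a) :
    ψ.onCompacts 1 T = ψ.unitHom a := by
  set y := ψ.onCompacts 1 T - ψ.unitHom a with hy
  have h1 : ∀ ζ : M.fiber 1, y * ψ.toFun 1 ζ = 0 := fun ζ => by
    rw [hy, sub_mul, onCompacts_mul_toFun, hT, sub_eq_zero]
    refine Eq.trans ?_ (ψ.map_mul (mul_one 1) _ ζ).symm
    rw [M.unit_mul, LinearEquiv.apply_symm_apply]
  let P : Submodule ℂ B :=
    { carrier := {z | y * star z = 0}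
      add_mem' := fun {a b} ha hb => by
        change y * star (a + b) = 0
        rw [star_add, mul_add, ha, hb, add_zero]
      zero_mem' := by simp
      smul_mem' := fun k z hz => by
        change y * star (k • z) = 0
        rw [star_smul, mul_smul_comm, hz, smul_zero] }
  have hP : IsClosed (P : Set B) :=
    isClosed_eq (continuous_const.mul continuous_star) continuous_const
  have h2 : y ∈ P := by
    refine P.sub_mem (ψ.onCompacts_mem hP (fun ξ η => ?_) T) ?_
    · change y * star _ = 0
      rw [star_mul, star_star, ← mul_assoc, h1, zero_mul]
    · change y * star _ = 0
      rw [← StarHomClass.map_star ψ.unitHom]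
      exact h1 _
  have h3 : y * star y = 0 := h2
  rw [CStarRing.mul_star_self_eq_zero_iff] at h3
  exact sub_eq_zero.mp h3

end Representation

/-- If `a` acts as zero, evaluating at `star a` gives `a * star a = 0`. -/
theorem left_one_injective : Function.Injective (M.left 1) := by
  rw [injective_iff_map_eq_zero]
  intro a ha
  have h := M.unit_left (M.unit.symm (star a)) a
  rw [ha, LinearEquiv.apply_symm_apply] at h
  have h0 : M.unit ((0 : Adjointable Aᵐᵒᵖ (M.fiber 1)) (M.unit.symm (star a))) = 0 :=
    map_zero M.unit
  rw [h0, eq_comm, CStarRing.mul_star_self_eq_zero_iff] at h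
  exact h

/-- On `M_1 = A` the operator `Θ_{ξ,η}` is left multiplication by `ξ η*`, and the left action is an
injective `*`-homomorphism, hence isometric with closed range. -/
theorem exists_eq_left_of_mem_compacts {T : Adjointable Aᵐᵒᵖ (M.fiber 1)}
    (hT : T ∈ compacts Aᵐᵒᵖ (M.fiber 1)) : ∃ a, T = M.left 1 a := by
  have hiso : Isometry (M.left 1) := NonUnitalStarAlgHom.isometry _ left_one_injective
  let f : A →ₗ[ℂ] Adjointable Aᵐᵒᵖ (M.fiber 1) :=
    { toFun := M.left 1, map_add' := map_add _, map_smul' := map_smul _ }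
  have h : compacts Aᵐᵒᵖ (M.fiber 1) ≤ LinearMap.range f := by
    refine compacts_induction ?_ fun ξ η => ?_
    · rw [LinearMap.coe_range]
      exact hiso.isClosedEmbedding.isClosed_range
    · refine ⟨M.unit ξ * star (M.unit η), adjointable_ext fun x => M.unit.injective ?_⟩
      change M.unit (M.left 1 _ x) = M.unit (MulOpposite.op (rinner A η x) • ξ)
      rw [M.unit_left, M.unit_right, M.rinner_unit, mul_assoc]
  obtain ⟨a, ha⟩ := h hT
  exact ⟨a, ha.symm⟩

/-- This is associativity with the first factor in `M_1 = A`. -/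
theorem left_apply_mul {p q r : S} (h : p * q = r) (a : A) (ξ : M.fiber p) (η : M.fiber q) :
    M.left r a (M.mul h ξ η) = M.mul h (M.left p a ξ) η := by
  have h1 := M.assoc (one_mul p) h h (one_mul r) (M.unit.symm a) ξ η
  rw [M.unit_mul, M.unit_mul, LinearEquiv.apply_symm_apply] at h1
  exact h1.symm

/-- Right multiplication by `η ∈ M_q`, as a bounded operator `M_p → M_{pq}`. -/
noncomputable def mulRightL {p q r : S} (h : p * q = r) (η : M.fiber q) :
    M.fiber p →L[ℂ] M.fiber r :=
  ((M.mul h).flip η).mkContinuous ‖η‖ fun ξ => by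
    rw [mul_comm]; exact norm_mul_apply_le h ξ η

theorem clm_ext_of_span_dense {E F : Type*} [NormedAddCommGroup E] [NormedSpace ℂ E]
    [NormedAddCommGroup F] [NormedSpace ℂ F] {D : Set E}
    (hD : (Submodule.span ℂ D).topologicalClosure = ⊤) {f g : E →L[ℂ] F}
    (h : ∀ x ∈ D, f x = g x) : f = g :=
  ContinuousLinearMap.ext_on (Submodule.dense_iff_topologicalClosure_eq_top.mpr hD) h

theorem adjointable_ext_of_dense_mul {p q r : S} {h : p * q = r}
    (hd : (Submodule.span ℂ {z : M.fiber r | ∃ x y, z = M.mul h x y}).topologicalClosure = ⊤)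
    {R R' : Adjointable Aᵐᵒᵖ (M.fiber r)}
    (hR : ∀ x y, R (M.mul h x y) = R' (M.mul h x y)) : R = R' :=
  Subtype.ext (clm_ext_of_span_dense hd (by rintro _ ⟨x, y, rfl⟩; exact hR x y))

/-! ### The maps `ι_p^r` and the diagonal entries of the Fock representation -/

section LeftCancel

variable [IsLeftCancelMul S]

theorem IsTensorId.apply_mul {p q r : S} {T : Adjointable Aᵐᵒᵖ (M.fiber p)}
    {R : Adjointable Aᵐᵒᵖ (M.fiber r)} (hR : M.IsTensorId T R) (h : p * q = r)
    (ξ : M.fiber p) (η : M.fiber q) : R (M.mul h ξ η) = M.mul h (T ξ) η := by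
  obtain ⟨q', h', hR, -⟩ := hR
  obtain rfl : q = q' := mul_left_cancel (h.trans h'.symm)
  exact hR ξ η

/-- For `p ≠ 1` density of `M_p M_q` decides. For `p = 1` compactness is needed: it makes `T` a left
multiplication, and only on those is the value prescribed. -/
theorem IsTensorId.unique {p r : S} {T : Adjointable Aᵐᵒᵖ (M.fiber p)}
    (hT : T ∈ compacts Aᵐᵒᵖ (M.fiber p)) {R R' : Adjointable Aᵐᵒᵖ (M.fiber r)}
    (hR : M.IsTensorId T R) (hR' : M.IsTensorId T R') : R = R' := by
  by_cases hp : p = 1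
  · subst hp
    obtain ⟨a, ha⟩ := exists_eq_left_of_mem_compacts hT
    obtain ⟨_, _, -, h1⟩ := hR
    obtain ⟨_, _, -, h2⟩ := hR'
    rw [h1 rfl a ha, h2 rfl a ha]
  · obtain ⟨q, h, -, -⟩ := id hR
    exact adjointable_ext_of_dense_mul (M.dense_mul h hp) fun x y => by
      rw [hR.apply_mul, hR'.apply_mul]

theorem fockOp_single {p q r : S} (h : p * q = r) (ξ : M.fiber p) (η : M.fiber q) :
    fockOp ξ (HilbertSum.single q η : M.Fock) = HilbertSum.single r (M.mul h ξ η) := by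
  refine HilbertSum.ext fun t => ?_
  rcases eq_or_ne t r with rfl | ht
  · rw [fockOp_apply_mul h, HilbertSum.single_apply_self, HilbertSum.single_apply_self]
  · rw [HilbertSum.single_apply_of_ne ht]
    by_cases h' : ∃ s, p * s = t
    · obtain ⟨s, rfl⟩ := h'
      have hs : s ≠ q := fun hs => ht (by rw [hs, h])
      rw [fockOp_apply_mul rfl, HilbertSum.single_apply_of_ne hs, map_zero]
    · exact fockOp_apply_eq_zero h' _ _

theorem fockRep_toFun {p : S} (ξ : M.fiber p) : M.fockRep.toFun p ξ = fockOp ξ := rfl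

theorem fockRep_unitHom_apply (a : A) (η : M.Fock) (q : S) :
    (M.fockRep.unitHom a η) q = M.left q a (η q) := fockOp_unit_apply a η q

/-- The condition is linear and closed, so it suffices to treat `ψ_F(ξ) ψ_F(η)*`, which maps the
summand `M_{ps}` to itself through `M_s` and kills the summands outside `pS`. -/
theorem fockRep_onCompacts_mem_diagonalOn {p : S} (T : compacts Aᵐᵒᵖ (M.fiber p)) :
    M.fockRep.onCompacts p T ∈ HilbertSum.diagonalOn (principalRightIdeal p) := by
  refine Representation.onCompacts_mem _ (HilbertSum.isClosed_diagonalOn _) (fun ξ η x t hx => ?_) T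
  change (fockOp ξ (star (fockOp η) x)) t = 0
  by_cases h : ∃ s, p * s = t
  · obtain ⟨s, rfl⟩ := h
    rw [fockOp_apply_mul rfl, star_fockOp_apply, hx ⟨s, rfl⟩, map_zero, map_zero]
  · exact fockOp_apply_eq_zero h _ _

/-- The vector `ξη` in the summand `M_t` is `ψ_F(ξ)` applied to `η` in `M_q`, and `ψ_F^{(p)}(T)
ψ_F(ξ) = ψ_F(Tξ)`. This yields `T ⊗ id` without constructing it on a tensor product. -/
theorem isTensorId_diagEntry_fockRep {p q t : S} (h : p * q = t)
    (T : compacts Aᵐᵒᵖ (M.fiber p)) :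
    M.IsTensorId T.1 (HilbertSum.diagEntry t (M.fockRep.onCompacts p T)) := by
  refine ⟨q, h, fun ξ η => ?_, ?_⟩
  · rw [HilbertSum.diagEntry_apply, ← fockOp_single h ξ η, ← adjointable_mul_apply,
      ← fockRep_toFun, Representation.onCompacts_mul_toFun, fockRep_toFun, fockOp_single h,
      HilbertSum.single_apply_self]
  · rintro rfl a ha
    refine adjointable_ext fun x => ?_
    rw [HilbertSum.diagEntry_apply, Representation.onCompacts_left _ ha, fockRep_unitHom_apply,
      HilbertSum.single_apply_self]

/-- The Fock representation supplies a witness, so the default value `0` in `iota` does not occur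
when `t ∈ pS` and `T` is compact. -/
theorem isTensorId_iota {p q t : S} (h : p * q = t) {T : Adjointable Aᵐᵒᵖ (M.fiber p)}
    (hT : T ∈ compacts Aᵐᵒᵖ (M.fiber p)) : M.IsTensorId T (M.iota p t T) := by
  have hex : ∃ R : Adjointable Aᵐᵒᵖ (M.fiber t), M.IsTensorId T R :=
    ⟨_, isTensorId_diagEntry_fockRep h ⟨T, hT⟩⟩
  rw [iota, dif_pos hex]
  exact hex.choose_spec

theorem iota_left {p : S} {a : A} (ha : M.left 1 a ∈ compacts Aᵐᵒᵖ (M.fiber 1)) :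
    M.iota 1 p (M.left 1 a) = M.left p a := by
  obtain ⟨_, _, -, h⟩ := isTensorId_iota (one_mul p) ha
  exact h rfl a rfl

/-- `ψ_F^{(p)}(T)` acts on `M_t ⊂ F(M)`, `t ∈ pS`, by `ι_p^t(T)`. -/
theorem fockRep_onCompacts_apply {p q t : S} (h : p * q = t) (T : compacts Aᵐᵒᵖ (M.fiber p))
    (ζ : M.Fock) : (M.fockRep.onCompacts p T ζ) t = M.iota p t T (ζ t) := by
  rw [HilbertSum.apply_eq_diagEntry (fockRep_onCompacts_mem_diagonalOn T),
    (isTensorId_diagEntry_fockRep h T).unique T.2 (isTensorId_iota h T.2)]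

theorem fockRep_onCompacts_apply_eq_zero {p t : S} (h : t ∉ principalRightIdeal p)
    (T : compacts Aᵐᵒᵖ (M.fiber p)) (ζ : M.Fock) : (M.fockRep.onCompacts p T ζ) t = 0 :=
  fockRep_onCompacts_mem_diagonalOn T ζ t fun h' => absurd h' h

/-- For `p ≠ 1` the vectors `yz` with `y ∈ M_p`, `z ∈ M_s` span a dense subspace of `M_r`, and there
associativity moves `T` onto `y` on both sides. For `p = 1` both sides are given by the left action
of `A`. -/
theorem iota_apply_mul {p s r x t : S} (hr : p * s = r) (ht : r * x = t)
    {T : Adjointable Aᵐᵒᵖ (M.fiber p)} (hT : T ∈ compacts Aᵐᵒᵖ (M.fiber p))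
    (ξ : M.fiber r) (η : M.fiber x) :
    M.iota p t T (M.mul ht ξ η) = M.mul ht (M.iota p r T ξ) η := by
  by_cases hp : p = 1
  · subst hp
    obtain ⟨a, rfl⟩ := exists_eq_left_of_mem_compacts hT
    rw [iota_left hT, iota_left hT, left_apply_mul]
  · have ht' : p * (s * x) = t := by rw [← mul_assoc, hr, ht]
    have h : (M.iota p t T).1 ∘L mulRightL ht η = mulRightL ht η ∘L (M.iota p r T).1 := by
      refine clm_ext_of_span_dense (M.dense_mul hr hp) ?_
      rintro _ ⟨y, z, rfl⟩
      change M.iota p t T (M.mul ht (M.mul hr y z) η) =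
        M.mul ht (M.iota p r T (M.mul hr y z)) η
      rw [M.assoc hr ht rfl ht', (isTensorId_iota ht' hT).apply_mul ht',
        (isTensorId_iota hr hT).apply_mul hr, M.assoc hr ht rfl ht']
    exact congrArg (fun f => f ξ) h

/-- If `S` has a nontrivial unit, then `A` acts nondegenerately on every fibre. -/
theorem dense_one_mul_of_unit {u v : S} (huv : u * v = 1) (hu : u ≠ 1) {t : S}
    (ht : 1 * t = t) :
    (Submodule.span ℂ {z : M.fiber t | ∃ x y, z = M.mul ht x y}).topologicalClosure = ⊤ := by
  have hvu : v * u = 1 := mul_left_cancel (a := u) (by rw [← mul_assoc, huv, one_mul, mul_one])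
  have hv : v ≠ 1 := by rintro rfl; exact hu (by simpa using huv)
  have hut : u * (v * t) = t := by rw [← mul_assoc, huv, one_mul]
  have huu : 1 * u = u := one_mul u
  set P := (Submodule.span ℂ {z : M.fiber t | ∃ x y, z = M.mul ht x y}).topologicalClosure
  have hP : IsClosed (P : Set (M.fiber t)) := Submodule.isClosed_topologicalClosure _
  have key : ∀ {E : Type w} [NormedAddCommGroup E] [NormedSpace ℂ E] (f : E →L[ℂ] M.fiber t)
      (D : Set E), (Submodule.span ℂ D).topologicalClosure = ⊤ → (∀ x ∈ D, f x ∈ P) →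
      ∀ x, f x ∈ P := by
    intro E _ _ f D hD h x
    have h1 : (Submodule.span ℂ D).topologicalClosure ≤ P.comap f.toLinearMap :=
      Submodule.topologicalClosure_minimal _ (Submodule.span_le.mpr h) (hP.preimage f.continuous)
    rw [hD] at h1
    exact h1 Submodule.mem_top
  rw [eq_top_iff]
  intro z _
  -- `M_t` is approximated by `M_u M_{vt}`, then `M_u` by `M_u M_1`, then `M_1` by `M_v M_u`.
  -- Regrouping `(x(bc))y` as `(xb)(cy)` puts `xb` in `M_1` and `cy` in `M_t`.
  refine key (ContinuousLinearMap.id ℂ _) _ (M.dense_mul hut hu) ?_ z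
  rintro _ ⟨x, y, rfl⟩
  refine key (mulRightL hut y) _ (M.dense_mul (mul_one u) hu) ?_ x
  rintro _ ⟨x, a, rfl⟩
  refine key (mulRightL hut y ∘L creation (mul_one u) x) _ (M.dense_mul hvu hv) ?_ a
  rintro _ ⟨b, c, rfl⟩
  change M.mul hut (M.mul (mul_one u) x (M.mul hvu b c)) y ∈ P
  rw [← M.assoc huv huu hvu (mul_one u), M.assoc huu hut hut ht]
  exact Submodule.le_topologicalClosure _ (Submodule.subset_span ⟨_, _, rfl⟩)

/-- Only `r = 1` needs an argument, and then `p` is a nontrivial unit with inverse `s`. -/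
theorem dense_mul_of_ne_one {p s r x t : S} (hs : p * s = r) (hp : p ≠ 1) (h : r * x = t) :
    (Submodule.span ℂ {z : M.fiber t | ∃ x y, z = M.mul h x y}).topologicalClosure = ⊤ := by
  by_cases hr : r = 1
  · subst hr
    obtain rfl : x = t := by simpa using h
    exact dense_one_mul_of_unit hs hp h
  · exact M.dense_mul h hr

/-- By `iota_apply_mul` both sides agree on products `ξη` with `ξ ∈ M_r`, `η ∈ M_x`, so density of
these suffices. It is available unless `p = q = r = 1`, and in that case `T` and `T'` are left
multiplications by some `a` and `b`, and both sides are the left action of `ab`. -/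
theorem iota_iota_mul_iota {p q r s s' x t : S} (hs : p * s = r) (hs' : q * s' = r)
    (h : r * x = t) {T : Adjointable Aᵐᵒᵖ (M.fiber p)} {T' : Adjointable Aᵐᵒᵖ (M.fiber q)}
    (hT : T ∈ compacts Aᵐᵒᵖ (M.fiber p)) (hT' : T' ∈ compacts Aᵐᵒᵖ (M.fiber q))
    (hK : M.iota p r T * M.iota q r T' ∈ compacts Aᵐᵒᵖ (M.fiber r)) :
    M.iota r t (M.iota p r T * M.iota q r T') = M.iota p t T * M.iota q t T' := by
  have key : (Submodule.span ℂ {z : M.fiber t | ∃ x y, z = M.mul h x y}).topologicalClosure = ⊤ →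
      M.iota r t (M.iota p r T * M.iota q r T') = M.iota p t T * M.iota q t T' := fun hd =>
    adjointable_ext_of_dense_mul hd fun ξ η => by
      rw [(isTensorId_iota h hK).apply_mul h, adjointable_mul_apply, adjointable_mul_apply,
        iota_apply_mul hs' h hT', iota_apply_mul hs h hT]
  by_cases hp : p = 1
  · by_cases hq : q = 1
    · by_cases hr : r = 1
      · subst hp hq hr
        obtain ⟨a, rfl⟩ := exists_eq_left_of_mem_compacts hT
        obtain ⟨b, rfl⟩ := exists_eq_left_of_mem_compacts hT'
        simp only [iota_left hT, iota_left hT', ← map_mul] at hK ⊢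
        exact iota_left hK
      · exact key (M.dense_mul h hr)
    · exact key (dense_mul_of_ne_one hs' hq h)
  · exact key (dense_mul_of_ne_one hs hp h)

end LeftCancel

/-! ### Nica covariance of the Fock representation and its injectivity on `A` -/

theorem fockRep_nicaCovariant [IsRightLCM S] (hM : M.CompactlyAligned) :
    M.fockRep.NicaCovariant hM := by
  intro p q T T'
  -- Both factors are diagonal, so a coordinate of the product vanishes as soon as one factor does.
  -- This covers the case of disjoint ideals and the coordinates outside `rS`.
  have hzero : ∀ t : S, t ∉ principalRightIdeal p ∩ principalRightIdeal q → ∀ ζ : M.Fock,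
      ((M.fockRep.onCompacts p T * M.fockRep.onCompacts q T') ζ) t = 0 := by
    intro t ht ζ
    rw [adjointable_mul_apply]
    by_cases hp : t ∈ principalRightIdeal p
    · have hq : t ∉ principalRightIdeal q := fun hq => ht ⟨hp, hq⟩
      exact fockRep_onCompacts_mem_diagonalOn T _ t fun _ =>
        fockRep_onCompacts_apply_eq_zero hq T' ζ
    · exact fockRep_onCompacts_apply_eq_zero hp T _
  refine ⟨fun r hr => ?_, fun h => ?_⟩
  · refine adjointable_ext fun ζ => HilbertSum.ext fun t => ?_
    by_cases ht : t ∈ principalRightIdeal r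
    · obtain ⟨⟨s, hs⟩, s', hs'⟩ : r ∈ principalRightIdeal p ∩ principalRightIdeal q :=
        hr ▸ ⟨1, mul_one r⟩
      obtain ⟨⟨x, hx⟩, x', hx'⟩ : t ∈ principalRightIdeal p ∩ principalRightIdeal q := hr ▸ ht
      obtain ⟨y, hy⟩ := ht
      rw [fockRep_onCompacts_apply hy, iota_iota_mul_iota hs hs' hy T.2 T'.2
          (hM p q r hr T T.2 T' T'.2),
        adjointable_mul_apply, adjointable_mul_apply, fockRep_onCompacts_apply hx,
        fockRep_onCompacts_apply hx']
    · rw [fockRep_onCompacts_apply_eq_zero ht]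
      exact hzero t (hr ▸ ht) ζ
  · have hempty : principalRightIdeal p ∩ principalRightIdeal q = ∅ :=
      (IsRightLCM.inter_eq p q).resolve_right h
    exact adjointable_ext fun ζ => HilbertSum.ext fun t => hzero t (by simp [hempty]) ζ

/-- It is enough to look at the summand `M_1` of the Fock module. -/
theorem fockRep_unitHom_injective [IsLeftCancelMul S] :
    Function.Injective M.fockRep.unitHom := by
  rw [injective_iff_map_eq_zero]
  intro a ha
  refine left_one_injective (M := M) ((adjointable_ext fun x => ?_).trans (map_zero _).symm)
  have h := fockRep_unitHom_apply a (HilbertSum.single 1 x : M.Fock) 1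
  rw [ha, HilbertSum.single_apply_self] at h
  exact h.symm

end ProductSystem

/-! ### Universal C*-algebras -/

/-- Formal `*`-polynomials without constant term in the noncommuting variables `G`. -/
inductive StarPoly (G : Type u) : Type u
  | zero : StarPoly G
  | var : G → StarPoly G
  | add : StarPoly G → StarPoly G → StarPoly G
  | mul : StarPoly G → StarPoly G → StarPoly G
  | smul : ℂ → StarPoly G → StarPoly G
  | star : StarPoly G → StarPoly G

namespace StarPoly

variable {G : Type u} {B : Type v} {B' : Type w} [NonUnitalCStarAlgebra B]
  [NonUnitalCStarAlgebra B']

/-- The value of a formal `*`-polynomial. -/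
def eval (f : G → B) : StarPoly G → B
  | zero => 0
  | var g => f g
  | add s t => eval f s + eval f t
  | mul s t => eval f s * eval f t
  | smul k t => k • eval f t
  | star t => Star.star (eval f t)

theorem map_eval (Φ : B →⋆ₙₐ[ℂ] B') {f : G → B} {f' : G → B'} (h : ∀ g, Φ (f g) = f' g)
    (t : StarPoly G) : Φ (eval f t) = eval f' t := by
  induction t with
  | zero => exact map_zero Φ
  | var g => exact h g
  | add s t hs ht => rw [eval, eval, map_add, hs, ht]
  | mul s t hs ht => rw [eval, eval, map_mul, hs, ht]
  | smul k t ht => rw [eval, eval, map_smul, ht]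
  | star t ht => rw [eval, eval, map_star, ht]

theorem exists_eval_eq {f : G → B} {x : B}
    (hx : x ∈ NonUnitalStarAlgebra.adjoin ℂ (Set.range f)) : ∃ t, eval f t = x := by
  induction hx using NonUnitalStarAlgebra.adjoin_induction with
  | mem x hx => obtain ⟨g, rfl⟩ := hx; exact ⟨var g, rfl⟩
  | add x y _ _ hx hy =>
    obtain ⟨s, rfl⟩ := hx
    obtain ⟨t, rfl⟩ := hy
    exact ⟨add s t, rfl⟩
  | zero => exact ⟨zero, rfl⟩
  | mul x y _ _ hx hy =>
    obtain ⟨s, rfl⟩ := hx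
    obtain ⟨t, rfl⟩ := hy
    exact ⟨mul s t, rfl⟩
  | smul k x _ hx =>
    obtain ⟨t, rfl⟩ := hx
    exact ⟨smul k t, rfl⟩
  | star x _ hx =>
    obtain ⟨t, rfl⟩ := hx
    exact ⟨star t, rfl⟩

/-- If `f` generates `B` and every `*`-polynomial in `f'` is dominated in norm by the same
`*`-polynomial in `f`, then `f g ↦ f' g` extends to a `*`-homomorphism. -/
theorem exists_starAlgHom {f : G → B} {f' : G → B'}
    (hf : (NonUnitalStarAlgebra.adjoin ℂ (Set.range f)).topologicalClosure = ⊤)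
    (h : ∀ t, ‖eval f' t‖ ≤ ‖eval f t‖) : ∃ Φ : B →⋆ₙₐ[ℂ] B', ∀ g, Φ (f g) = f' g := by
  -- `D` is the closed graph of the desired homomorphism. The norm domination persists on the
  -- closure, so `D` is single-valued and its first projection is isometric. The image of that
  -- projection is thus closed and contains the generators, so it is all of `B`.
  let D := (NonUnitalStarAlgebra.adjoin ℂ (Set.range fun g => (f g, f' g))).topologicalClosure
  have hD : IsClosed (D : Set (B × B')) :=
    NonUnitalStarSubalgebra.isClosed_topologicalClosure _
  have hmem : ∀ g, (f g, f' g) ∈ D := fun g =>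
    NonUnitalStarSubalgebra.le_topologicalClosure _
      (NonUnitalStarAlgebra.subset_adjoin ℂ _ ⟨g, rfl⟩)
  have bd : ∀ x ∈ D, ‖x.2‖ ≤ ‖x.1‖ := by
    intro x hx
    refine closure_minimal (fun y hy => ?_)
      (isClosed_le continuous_snd.norm continuous_fst.norm) hx
    obtain ⟨t, rfl⟩ := exists_eval_eq hy
    change ‖NonUnitalStarAlgHom.snd ℂ B B' _‖ ≤ ‖NonUnitalStarAlgHom.fst ℂ B B' _‖
    rw [map_eval (f' := f') _ fun _ => rfl, map_eval (f' := f) _ fun _ => rfl]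
    exact h t
  have huniq : ∀ {b c c'}, (b, c) ∈ D → (b, c') ∈ D → c = c' := by
    intro b c c' h h'
    have h1 := bd _ (sub_mem h h')
    simp only [Prod.mk_sub_mk, sub_self, norm_zero] at h1
    exact sub_eq_zero.mp (norm_le_zero_iff.mp h1)
  have hclosed : IsClosed (D.map (NonUnitalStarAlgHom.fst ℂ B B') : Set B) := by
    have : CompleteSpace D := hD.completeSpace_coe
    have hiso : Isometry fun x : D => x.1.1 := Isometry.of_dist_eq fun x y => by
      rw [Subtype.dist_eq, dist_eq_norm, dist_eq_norm, ← Prod.fst_sub]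
      change _ = max _ _
      rw [max_eq_left (bd _ (sub_mem x.2 y.2))]
    convert hiso.isClosedEmbedding.isClosed_range using 1
    ext x
    simp
  have hall : ∀ b, ∃ c, (b, c) ∈ D := by
    intro b
    have h1 : (NonUnitalStarAlgebra.adjoin ℂ (Set.range f)).topologicalClosure ≤
        D.map (NonUnitalStarAlgHom.fst ℂ B B') := by
      refine NonUnitalStarSubalgebra.topologicalClosure_minimal _
        (NonUnitalStarAlgebra.adjoin_le ?_) hclosed
      rintro _ ⟨g, rfl⟩
      exact ⟨_, hmem g, rfl⟩
    rw [hf] at h1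
    obtain ⟨⟨_, c⟩, hc, rfl⟩ := h1 (x := b) trivial
    exact ⟨c, hc⟩
  choose Φ hΦ using hall
  exact ⟨{
    toFun := Φ
    map_smul' := fun k x => huniq (hΦ _) (SMulMemClass.smul_mem k (hΦ x))
    map_zero' := huniq (hΦ _) (zero_mem D)
    map_add' := fun x y => huniq (hΦ _) (add_mem (hΦ x) (hΦ y))
    map_mul' := fun x y => huniq (hΦ _) (mul_mem (hΦ x) (hΦ y))
    map_star' := fun x => huniq (hΦ _) (star_mem (hΦ x)) }, fun g => huniq (hΦ _) (hmem g)⟩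

end StarPoly

/-- A coordinate projection of an `ℓ^∞`-product of C*-algebras. -/
def lpEvalHom {ι : Type u} (B : ι → Type v) [∀ i, NonUnitalCStarAlgebra (B i)] (i : ι) :
    lp B ⊤ →⋆ₙₐ[ℂ] B i where
  toFun x := x i
  map_smul' _ _ := rfl
  map_zero' := rfl
  map_add' _ _ := rfl
  map_mul' _ _ := rfl
  map_star' _ := rfl

/-! ### Construction of the Nica-Toeplitz algebra -/

namespace ProductSystem

variable {A : Type u} [NonUnitalCStarAlgebra A] [PartialOrder A] [StarOrderedRing A]
  {S : Type v} [Monoid S] {M : ProductSystem.{u, v, w} A S}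

namespace Representation

theorem map_onCompacts {B B' : Type*} [NonUnitalCStarAlgebra B] [NonUnitalCStarAlgebra B']
    {ψ : M.Representation B} {ψ' : M.Representation B'} (Φ : B →⋆ₙₐ[ℂ] B')
    (h : ∀ p ξ, Φ (ψ.toFun p ξ) = ψ'.toFun p ξ) (p : S) (T : compacts Aᵐᵒᵖ (M.fiber p)) :
    Φ (ψ.onCompacts p T) = ψ'.onCompacts p T := by
  let ΦL : B →L[ℂ] B' := LinearMap.mkContinuous
    { toFun := Φ, map_add' := map_add _, map_smul' := map_smul _ } 1
    fun x => by rw [one_mul]; exact NonUnitalStarAlgHom.norm_apply_le Φ x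
  have h1 : ΦL ∘L ψ.onCompacts p = ψ'.onCompacts p := compacts_hom_ext fun ξ η => by
    change Φ (ψ.onCompacts p _) = _
    rw [onCompacts_rankOne, onCompacts_rankOne, _root_.map_mul, StarHomClass.map_star, h, h]
  exact congrArg (fun f => f T) h1

/-- Covariance consists of equations between elements built from the `ψ^{(p)}`, which
`*`-homomorphisms intertwine. It can therefore be tested on a family that separates points. -/
theorem nicaCovariant_of_forall {hM : M.CompactlyAligned} {B : Type*} [NonUnitalCStarAlgebra B]
    {ψ : M.Representation B} {ι : Type*} {B' : ι → Type*} [∀ i, NonUnitalCStarAlgebra (B' i)]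
    {ψ' : ∀ i, M.Representation (B' i)} (Φ : ∀ i, B →⋆ₙₐ[ℂ] B' i)
    (hΦ : ∀ b c, (∀ i, Φ i b = Φ i c) → b = c)
    (h : ∀ i p ξ, Φ i (ψ.toFun p ξ) = (ψ' i).toFun p ξ)
    (hψ' : ∀ i, (ψ' i).NicaCovariant hM) : ψ.NicaCovariant hM := by
  refine fun p q T T' => ⟨fun r hr => hΦ _ _ fun i => ?_, fun hr => hΦ _ _ fun i => ?_⟩
  · rw [_root_.map_mul, map_onCompacts _ (h i), map_onCompacts _ (h i), map_onCompacts _ (h i)]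
    exact (hψ' i p q T T').1 r hr
  · rw [_root_.map_mul, map_onCompacts _ (h i), map_onCompacts _ (h i), map_zero]
    exact (hψ' i p q T T').2 hr

/-- A representation, as a family of elements indexed by the disjoint union of the fibres. -/
def gens {B : Type*} [NonUnitalCStarAlgebra B] (ψ : M.Representation B)
    (g : Σ p, M.fiber p) : B := ψ.toFun g.1 g.2

theorem range_gens {B : Type*} [NonUnitalCStarAlgebra B] (ψ : M.Representation B) :
    Set.range ψ.gens = {b | ∃ (p : S) (ξ : M.fiber p), b = ψ.toFun p ξ} := by
  ext b
  constructor
  · rintro ⟨⟨p, ξ⟩, rfl⟩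
    exact ⟨p, ξ, rfl⟩
  · rintro ⟨p, ξ, rfl⟩
    exact ⟨⟨p, ξ⟩, rfl⟩

/-- The product of a family of representations. -/
def pi {ι : Type*} {B : ι → Type*} [∀ i, NonUnitalCStarAlgebra (B i)]
    (ψ : ∀ i, M.Representation (B i)) : M.Representation (lp B ⊤) where
  toFun p :=
    { toFun := fun ξ => ⟨fun i => (ψ i).toFun p ξ, memℓp_infty
        ⟨‖ξ‖, by rintro _ ⟨i, rfl⟩; exact (ψ i).norm_toFun_le ξ⟩⟩
      map_add' := fun ξ η => Subtype.ext (funext fun i => map_add _ _ _)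
      map_smul' := fun k ξ => Subtype.ext (funext fun i => map_smul _ _ _) }
  map_mul h ξ η := Subtype.ext (funext fun i => (ψ i).map_mul h ξ η)
  map_star a := Subtype.ext (funext fun i => (ψ i).map_star a)
  map_rinner p ξ η := Subtype.ext (funext fun i => (ψ i).map_rinner p ξ η)

/-- The C*-algebra generated by a representation. -/
def generated {B : Type*} [NonUnitalCStarAlgebra B] (ψ : M.Representation B) :
    NonUnitalStarSubalgebra ℂ B :=
  (NonUnitalStarAlgebra.adjoin ℂ (Set.range ψ.gens)).topologicalClosure

noncomputable instance {B : Type*} [NonUnitalCStarAlgebra B] (ψ : M.Representation B) :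
    NonUnitalCStarAlgebra ψ.generated :=
  NonUnitalStarSubalgebra.nonUnitalCStarAlgebra _
    (h_closed := NonUnitalStarSubalgebra.isClosed_topologicalClosure _)

theorem toFun_mem_generated {B : Type*} [NonUnitalCStarAlgebra B] (ψ : M.Representation B)
    {p : S} (ξ : M.fiber p) : ψ.toFun p ξ ∈ ψ.generated :=
  NonUnitalStarSubalgebra.le_topologicalClosure _
    (NonUnitalStarAlgebra.subset_adjoin ℂ _ ⟨⟨p, ξ⟩, rfl⟩)

/-- A representation, as a representation in the C*-algebra it generates. -/
def toGenerated {B : Type*} [NonUnitalCStarAlgebra B] (ψ : M.Representation B) :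
    M.Representation ψ.generated where
  toFun p :=
    { toFun := fun ξ => ⟨ψ.toFun p ξ, ψ.toFun_mem_generated ξ⟩
      map_add' := fun _ _ => Subtype.ext (map_add _ _ _)
      map_smul' := fun _ _ => Subtype.ext (map_smul _ _ _) }
  map_mul h ξ η := Subtype.ext (ψ.map_mul h ξ η)
  map_star a := Subtype.ext (ψ.map_star a)
  map_rinner p ξ η := Subtype.ext (ψ.map_rinner p ξ η)

theorem adjoin_toGenerated {B : Type*} [NonUnitalCStarAlgebra B] (ψ : M.Representation B) :
    (NonUnitalStarAlgebra.adjoin ℂ (Set.range ψ.toGenerated.gens)).topologicalClosure = ⊤ := by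
  rw [eq_top_iff]
  intro x _
  change x ∈ closure _
  rw [closure_subtype]
  refine closure_mono ?_ x.2
  have h := NonUnitalStarAlgHom.map_adjoin (R := ℂ)
    (NonUnitalStarSubalgebraClass.subtype ψ.generated) (Set.range ψ.toGenerated.gens)
  rw [← Set.range_comp] at h
  exact (congrArg SetLike.coe h).ge

end Representation

/-- A compactly aligned product system has a Nica-Toeplitz algebra. -/
theorem exists_isNicaToeplitz (hM : M.CompactlyAligned) :
    ∃ (N : Type (max v w)) (_ : NonUnitalCStarAlgebra N) (j : M.Representation N),
      IsNicaToeplitz hM j := by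
  -- All Nica covariant representations together are too large to index a product within the
  -- universe. Their norm functions on `*`-polynomials form a type of the right size, and one
  -- representation is chosen for each such function.
  let I : Type (max v w) := {n : StarPoly (Σ p, M.fiber p) → ℝ //
    ∃ (B : Type (max v w)) (_ : NonUnitalCStarAlgebra B) (ψ : M.Representation B),
      ψ.NicaCovariant hM ∧ ∀ t, n t = ‖StarPoly.eval ψ.gens t‖}
  choose B instB ψ hψ hn using fun n : I => n.2
  let j₀ : M.Representation (lp B ⊤) := Representation.pi ψ
  let Φ : ∀ n, j₀.generated →⋆ₙₐ[ℂ] B n := fun n =>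
    (lpEvalHom B n).comp (NonUnitalStarSubalgebraClass.subtype j₀.generated)
  refine ⟨j₀.generated, inferInstance, j₀.toGenerated, ?_, ?_, ?_⟩
  · exact Representation.nicaCovariant_of_forall Φ
      (fun b c h => Subtype.ext (Subtype.ext (funext h))) (fun _ _ _ => rfl) hψ
  · rw [← Representation.range_gens]
    exact j₀.adjoin_toGenerated
  · intro B' _ ψ' hψ'
    -- The representation chosen for this index need not be `ψ'`, but it gives every `*`-polynomial
    -- the same norm. Projecting to that coordinate is contractive, which is the domination required
    -- by `exists_starAlgHom`.
    let n : I := ⟨fun t => ‖StarPoly.eval ψ'.gens t‖, B', _, ψ', hψ', fun _ => rfl⟩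
    obtain ⟨Ψ, hΨ⟩ := StarPoly.exists_starAlgHom (f' := ψ'.gens) j₀.adjoin_toGenerated fun t => by
      refine (hn n t).trans_le ?_
      rw [← StarPoly.map_eval (Φ n) (f := j₀.toGenerated.gens) (f' := (ψ n).gens) fun _ => rfl]
      exact NonUnitalStarAlgHom.norm_apply_le _ _
    exact ⟨Ψ, fun p ξ => hΨ ⟨p, ξ⟩⟩

end ProductSystem

theorem proposition6p5 {A : Type u} [NonUnitalCStarAlgebra A] [PartialOrder A] [StarOrderedRing A]
    {S : Type v} [Monoid S] [IsRightLCM S] (M : ProductSystem.{u, v, w} A S)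
    (hM : M.CompactlyAligned) :
    M.fockRep.NicaCovariant hM ∧
    (∃ (N : Type (max v w)) (_ : NonUnitalCStarAlgebra N) (j : M.Representation N),
      ProductSystem.IsNicaToeplitz hM j) ∧
    (Nontrivial A → ∀ (N : Type (max v w)) [NonUnitalCStarAlgebra N] (j : M.Representation N),
      ProductSystem.IsNicaToeplitz hM j → Nontrivial N) := by
  refine ⟨ProductSystem.fockRep_nicaCovariant hM, ProductSystem.exists_isNicaToeplitz hM, ?_⟩
  intro hA N _ j hj
  obtain ⟨Φ, hΦ⟩ := hj.universal _ M.fockRep (ProductSystem.fockRep_nicaCovariant hM)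
  -- The composite `A → N → 𝓛(F(M))` is the restriction of the Fock representation to `A`, so `A`
  -- already embeds in `N`.
  have hinj : Function.Injective fun a => Φ (j.unitHom a) := by
    have h : (fun a => Φ (j.unitHom a)) = M.fockRep.unitHom :=
      funext fun a => hΦ 1 (M.unit.symm a)
    rw [h]
    exact ProductSystem.fockRep_unitHom_injective
  exact (Function.Injective.of_comp (f := Φ) (g := j.unitHom) hinj).nontrivial
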